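/- Let $\lambda>0$, and let $F$, $F_0$ be cumulative distribution functions of probability distributions on $\mathbb R$ (the offer distribution and the residual price distribution). Let $X\sim F$ and $X_0\sim F_0$, and assume $E[\max(X,0)]<\infty$, $E[|X_0|]<\infty$ and $0\le \mu_0:=E[X_0]<M:=\sup\{x : F(x)<1\}\in(-\infty,\infty]$. An asset must be sold within a time $t\ge 0$. Offers $X_1,X_2,\dots$, i.i.d. with distribution $F$, arrive after i.i.d. durations $D_1,D_2,\dots$ that are exponential with rate $\lambda$; $X_0$ has distribution $F_0$, and all these variables are independent. The time remaining at the $i$-th offer is $t_i=\max(t_{i-1}-D_i,0)$, with $t_0=t$. A policy is a (measurable) rule that decides, from the time remaining $t_i$ and the value $X_i$, whether to accept the $i$-th offer. If $X_i$ is the first accepted offer and $t_i>0$, then the sale price is $X_i$ and the time to sale is $t-t_i$; if the deadline is reached before an offer is accepted, then the sale price is $X_0$ and the time to sale is $t$. Let $\mu(t)$ be the supremum over all policies of the expected sale price. Let $T_t$ be the time to sale under the optimal policy, which accepts an offer $x$ made with time $s$ remaining if and only if $x\ge\mu(s)$. Put $\hat T_t=T_t/t$ and $\hat H_t(s)=P(\hat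 T_t\le s)$. A measurable function $R:[0,\infty)\to[0,\infty)$ is called regularly varying with index $\rho$ if $\lim_{s\to\infty}R(xs)/R(s)=x^\rho$ for every $x>0$. We say that the limiting distribution of $\hat T_t$ exists if the limit $\hat H_\infty(s)=\lim_{t\to\infty}\hat H_t(s)$ exists for every $s\ge 0$ and $\hat H_\infty$ coincides on $[0,\infty)$ with the cumulative distribution function of a probability distribution on $\mathbb R$. **Theorem.** The function $\mu$ is differentiable on $[0,\infty)$ (one-sidedly at $0$), and the limiting distribution of $\hat T_t$ exists if and only if $\mu'$ is regularly varying with some index $\rho\le 0$. In this case, with $\gamma=-\rho$, $$\hat H_\infty(s)=\begin{cases}1-(1-s)^\gamma & 0\le s<1\\ 1 & s\ge 1,\end{cases}$$ and $$\lim_{t\to\infty}\frac{E[T_t]}{t}=\lim_{t\to\infty}E[\hat T_t]=\frac1{\gamma+1},\qquad \lim_{t\to\infty}\frac{\operatorname{Var}[T_t]}{t^2}=\lim_{t\to\infty}\operatorname{Var}[\hat T_t]=\frac{\gamma}{(\gamma+1)^2(\gamma+2)}.$$ -/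

import Mathlib

open MeasureTheory ProbabilityTheory Filter Topology

namespace CayleyMoser

noncomputable section

/-- The stochastic data of the bidding process on a probability space `(Ω, P)`: inter-arrival
durations `D n`, offers `X n` (the offer `X n` arrives after the durations `D 0, …, D n`) and the
residual price `X₀`. The durations are exponential with rate `lam`, the offers have law `ν`, the
residual price has law `ν₀`, and all of them are mutually independent. -/
structure IsBiddingData {Ω : Type*} [MeasurableSpace Ω] (P : Measure Ω) (lam : ℝ)
    (ν ν₀ : Measure ℝ) (D X : ℕ → Ω → ℝ) (X₀ : Ω → ℝ) : Prop where
  measurable_duration : ∀ n, Measurable (D n)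
  measurable_offer : ∀ n, Measurable (X n)
  measurable_residual : Measurable X₀
  law_duration : ∀ n, P.map (D n) = expMeasure lam
  law_offer : ∀ n, P.map (X n) = ν
  law_residual : P.map X₀ = ν₀
  indep : iIndepFun (Sum.elim D (Sum.elim X fun _ : Unit => X₀)) P

/-- The time remaining until the deadline: `remaining d t 0 = t`, and `remaining d t (n + 1)` is
the time remaining when the offer number `n` arrives, or `0` if it does not arrive in time. -/
def remaining (d : ℕ → ℝ) (t : ℝ) : ℕ → ℝ
  | 0 => t
  | n + 1 => max (remaining d t n - d n) 0

/-- A policy is a set `A` of pairs (time remaining, offer): the offers that are accepted.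
The process stops at step `n` if the deadline has been reached or the offer `x n` is accepted. -/
def StopsAt (A : Set (ℝ × ℝ)) (t : ℝ) (d x : ℕ → ℝ) (n : ℕ) : Prop :=
  remaining d t (n + 1) = 0 ∨ (remaining d t (n + 1), x n) ∈ A

open Classical in
/-- The realized sale price under the policy `A`, along one realization `d, x, x₀` and with initial
time `t` to the deadline (if the process never stops, an event of probability zero, it is `x₀`). -/
def salePrice (A : Set (ℝ × ℝ)) (t : ℝ) (d x : ℕ → ℝ) (x₀ : ℝ) : ℝ :=
  if h : ∃ n, StopsAt A t d x n then
    if remaining d t (Nat.find h + 1) = 0 then x₀ else x (Nat.find h)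
  else x₀

open Classical in
/-- The time to sale under the policy `A`, along one realization `d, x`
(if the process never stops, an event of probability zero, it is `t`). -/
def timeToSale (A : Set (ℝ × ℝ)) (t : ℝ) (d x : ℕ → ℝ) : ℝ :=
  if h : ∃ n, StopsAt A t d x n then t - remaining d t (Nat.find h + 1) else t

section Model

variable {Ω : Type*} [MeasurableSpace Ω] (P : Measure Ω) (D X : ℕ → Ω → ℝ) (X₀ : Ω → ℝ)

/-- The sale price obtained with the policy `A` as a random variable. -/
def saleRV (A : Set (ℝ × ℝ)) (t : ℝ) (ω : Ω) : ℝ :=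
  salePrice A t (fun n => D n ω) (fun n => X n ω) (X₀ ω)

/-- `optimalValue P D X X₀ t` is `μ(t)`: the supremum, over all measurable policies, of the expected
sale price when the time to the deadline is `t`. (When the offers have an integrable positive part,
a policy whose sale price is not integrable has expected sale price `-∞`, so it is left out.) -/
def optimalValue (t : ℝ) : ℝ :=
  sSup {v : ℝ | ∃ A : Set (ℝ × ℝ), MeasurableSet A ∧ Integrable (saleRV D X X₀ A t) P ∧
    v = ∫ ω, saleRV D X X₀ A t ω ∂P}

/-- The optimal policy: with remaining time `s`, accept the offer `x` if and only if it is at least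
the optimal expected sale price `μ(s)` that is obtained by waiting. -/
def optimalPolicy : Set (ℝ × ℝ) := {p | optimalValue P D X X₀ p.1 ≤ p.2}

/-- The time to sale `T_t` under the optimal policy. -/
def T (t : ℝ) (ω : Ω) : ℝ :=
  timeToSale (optimalPolicy P D X X₀) t (fun n => D n ω) (fun n => X n ω)

/-- The fraction `T_t / t` of the available time that is used. -/
def That (t : ℝ) (ω : Ω) : ℝ := T P D X X₀ t ω / t

/-- The cumulative distribution function of `T_t / t`. -/
def Hhat (t s : ℝ) : ℝ := P.real {ω | That P D X X₀ t ω ≤ s}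

/-- The limiting distribution of `T_t / t` exists: as `t → ∞`, the cumulative distribution functions
converge at every `s ≥ 0` to the cumulative distribution function of a probability measure. -/
def LimitingDistributionExists : Prop :=
  ∃ κ : Measure ℝ, IsProbabilityMeasure κ ∧
    ∀ s : ℝ, 0 ≤ s → Tendsto (fun t => Hhat P D X X₀ t s) atTop (𝓝 (cdf κ s))

end Model

/-- The upper end `M = sup {x | F x < 1}` of the support of a distribution. -/
def supSupport (ν : Measure ℝ) : EReal := sSup ((fun x : ℝ => (x : EReal)) '' {x : ℝ | cdf ν x < 1})

/-- A measurable function `R : [0, ∞) → [0, ∞)` that is regularly varying with index `ρ`. -/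
def RegularlyVarying (R : ℝ → ℝ) (ρ : ℝ) : Prop :=
  Measurable ((Set.Ici (0 : ℝ)).domRestrict R) ∧ (∀ s, 0 ≤ s → 0 ≤ R s) ∧
    ∀ x : ℝ, 0 < x → Tendsto (fun s => R (x * s) / R s) atTop (𝓝 (x ^ ρ))

end

end CayleyMoser

/-!
Let `φ m = E (X - m)⁺`. With time `s` left, the first arrival either misses the deadline or leaves
the larger of the offer and the value of continuing, so the optimal value should satisfy the renewal
equation `μ s = exp (-lam s) μ₀ + ∫₀ˢ lam exp (-lam (s - r)) (μ r + φ (μ r)) dr`, which amounts to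
the differential equation `μ' = lam φ (μ)`, `μ 0 = μ₀`. As `φ` is Lipschitz, the equation has a
global solution `y` (`exists_isValueCurve`). Along any policy, the process that equals `y` of the
remaining time before the sale and the positive part of the sale price afterwards is a
supermartingale, and it is a martingale for the policy that accepts the offers `x ≥ y`; optional
stopping (`tsum_pay_le`, `tsum_pay_eq`) gives `μ = y` on `[0, ∞)` (`optimalValue_eq`). The residual
price is independent of the event that it is paid, so it may be replaced by its mean. Payoffs are
then nonnegative, and Lebesgue integrals in `[0, ∞]` make most integrability questions disappear.

The convex function `φ` has right derivative `-P (X > m)`, so `q = μ'` satisfies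
`q' = -lam P (X > μ) q` from the right. This is the equation satisfied by the probability that no
offer is accepted while the remaining time is at least `r`, because the strictly increasing `μ`
meets the atoms of the offers only at countably many times. Optional stopping once more yields
`P (T_t > u) = μ' t / μ' (t - u)` for `0 ≤ u < t` (`measure_lt_T`).

Hence the distribution function of `T_t / t` at `s < 1` is `1 - μ' t / μ' ((1 - s) t)`, and regular
variation of `μ'` gives its limit and, by dominated convergence of the tails, the limits of the
moments. Conversely, if these ratios converge, the limit is multiplicative in `1 - s`, and right
continuity of the limiting distribution function at `0` keeps it positive; its logarithm is a
monotone additive function of `log (1 - s)`, thus linear (`exists_rpow_of_tendsto_cdf`).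
-/

namespace CayleyMoser

/-! ### The expected excess of an offer over a level -/

/-- The expected excess `E (X - m)⁺` of an offer with law `ν` over the level `m`. -/
noncomputable def excess (ν : Measure ℝ) (m : ℝ) : ℝ := ∫ x, max (x - m) 0 ∂ν

lemma excess_nonneg {ν : Measure ℝ} (m : ℝ) : 0 ≤ excess ν m :=
  integral_nonneg fun _ => le_max_right _ _

section Excess

variable {ν : Measure ℝ} [IsProbabilityMeasure ν]

lemma integrable_excess (hν : Integrable (fun x : ℝ => max x 0) ν) (m : ℝ) :
    Integrable (fun x : ℝ => max (x - m) 0) ν := by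
  refine (hν.add (integrable_const |m|)).mono' (by fun_prop) (ae_of_all _ fun x => ?_)
  rw [Real.norm_of_nonneg (le_max_right _ _)]
  simp only [Pi.add_apply]
  have := neg_abs_le m
  have := abs_nonneg m
  rcases max_cases (x - m) 0 with h | h <;> rcases max_cases x 0 with h' | h' <;> linarith

lemma excess_antitone (hν : Integrable (fun x : ℝ => max x 0) ν) : Antitone (excess ν) :=
  fun a b hab => integral_mono (integrable_excess hν b) (integrable_excess hν a) fun x =>
    max_le_max (by linarith) le_rfl

lemma abs_max_sub_sub_max_sub_le (x a b : ℝ) : |max (x - a) 0 - max (x - b) 0| ≤ |a - b| := by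
  have := abs_max_sub_max_le_abs (x - a) (x - b) 0
  rwa [sub_sub_sub_cancel_left, abs_sub_comm b a] at this

lemma lipschitzWith_excess (hν : Integrable (fun x : ℝ => max x 0) ν) :
    LipschitzWith 1 (excess ν) := by
  refine LipschitzWith.of_dist_le_mul fun a b => ?_
  rw [NNReal.coe_one, one_mul, Real.dist_eq, Real.dist_eq, excess, excess,
    ← integral_sub (integrable_excess hν a) (integrable_excess hν b)]
  have h := norm_integral_le_of_norm_le_const (μ := ν) (C := |a - b|)
    (f := fun x => max (x - a) 0 - max (x - b) 0)
    (ae_of_all _ fun x => abs_max_sub_sub_max_sub_le x a b)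
  simpa using h

/-- The expected excess is convex, and its right derivative at `m` is `-P (X > m)`. -/
lemma hasDerivWithinAt_excess (hν : Integrable (fun x : ℝ => max x 0) ν) (m : ℝ) :
    HasDerivWithinAt (excess ν) (-ν.real (Set.Ioi m)) (Set.Ici m) m := by
  rw [← hasDerivWithinAt_Ioi_iff_Ici, hasDerivWithinAt_iff_tendsto_slope'
    Set.self_notMem_Ioi]
  have hlim : ∫ x, (Set.Ioi m).indicator (fun _ => (-1 : ℝ)) x ∂ν = -ν.real (Set.Ioi m) := by
    rw [integral_indicator_const _ measurableSet_Ioi]; simp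
  rw [← hlim]
  have hslope : ∀ z, slope (excess ν) m z
      = ∫ x, (max (x - z) 0 - max (x - m) 0) / (z - m) ∂ν := fun z => by
    rw [integral_div, integral_sub (integrable_excess hν z) (integrable_excess hν m),
      slope_def_field, excess, excess]
  rw [funext hslope]
  refine tendsto_integral_filter_of_dominated_convergence (fun _ => 1) ?_ ?_
    (integrable_const _) ?_
  · exact Eventually.of_forall fun z => by fun_prop
  · filter_upwards [self_mem_nhdsWithin] with z hz
    refine ae_of_all _ fun x => ?_
    have hz' : 0 < z - m := sub_pos.2 hz
    rw [norm_div, Real.norm_eq_abs, Real.norm_eq_abs, div_le_one (abs_pos.2 hz'.ne')]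
    exact abs_max_sub_sub_max_sub_le x z m
  · refine ae_of_all _ fun x => ?_
    refine tendsto_const_nhds.congr' ?_
    rcases le_or_gt x m with hx | hx
    · filter_upwards [self_mem_nhdsWithin] with z hz
      have hz' : m < z := hz
      rw [Set.indicator_of_notMem (by simpa using hx), max_eq_right (by linarith),
        max_eq_right (by linarith), sub_zero, zero_div]
    · filter_upwards [Ioo_mem_nhdsGT hx] with z hz
      rw [Set.indicator_of_mem (show x ∈ Set.Ioi m from hx), max_eq_left (by linarith [hz.2]),
        max_eq_left (by linarith)]
      have : z - m ≠ 0 := (sub_pos.2 hz.1).ne'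
      field_simp
      ring

lemma excess_pos_of_lt_supSupport (hν : Integrable (fun x : ℝ => max x 0) ν) {m : ℝ}
    (hm : (m : EReal) < supSupport ν) : 0 < excess ν m := by
  obtain ⟨_, ⟨x, hx, rfl⟩, hmx⟩ := lt_sSup_iff.1 hm
  have hmx : m < x := EReal.coe_lt_coe_iff.1 hmx
  have hx : cdf ν x < 1 := hx
  have hpos : 0 < ν.real (Set.Ioi x) := by
    have := probReal_compl_eq_one_sub (μ := ν) (measurableSet_Iic (a := x))
    rw [Set.compl_Iic] at this
    rw [this, ← cdf_eq_real]
    linarith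
  have h1 : ∫ _ in Set.Ioi x, (x - m) ∂ν ≤ ∫ z in Set.Ioi x, max (z - m) 0 ∂ν := by
    refine setIntegral_mono_on (integrable_const _).integrableOn
      (integrable_excess hν m).integrableOn measurableSet_Ioi fun z hz => ?_
    exact le_max_of_le_left (by have : x < z := hz; linarith)
  have h2 : ∫ z in Set.Ioi x, max (z - m) 0 ∂ν ≤ excess ν m :=
    setIntegral_le_integral (integrable_excess hν m) (ae_of_all _ fun _ => le_max_right _ _)
  rw [setIntegral_const, smul_eq_mul] at h1
  exact (mul_pos hpos (sub_pos.2 hmx)).trans_le (h1.trans h2)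

end Excess

/-! ### Solutions of scalar autonomous equations with a bounded Lipschitz right-hand side -/

lemma exists_solution_on_Icc {f : ℝ → ℝ} {K L : NNReal} (hf : LipschitzWith K f)
    (hb : ∀ x, |f x| ≤ L) (x₀ : ℝ) (n : ℕ) :
    ∃ α : ℝ → ℝ, α 0 = x₀ ∧ ∀ t ∈ Set.Ioo (-((n : ℝ) + 1)) ((n : ℝ) + 1),
      HasDerivAt α (f (α t)) t := by
  have h0 : (0 : ℝ) ∈ Set.Icc (-((n : ℝ) + 1)) ((n : ℝ) + 1) :=
    ⟨by have : (0 : ℝ) ≤ n := n.cast_nonneg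
        linarith, by positivity⟩
  have hPL : IsPicardLindelof (fun _ => f) (⟨0, h0⟩ : Set.Icc (-((n : ℝ) + 1)) ((n : ℝ) + 1)) x₀
      (L * (n + 1)) 0 L K :=
    IsPicardLindelof.of_time_independent (fun x _ => hb x) hf.lipschitzOnWith (by simp)
  obtain ⟨α, hα0, hα⟩ := hPL.exists_eq_forall_mem_Icc_hasDerivWithinAt₀
  exact ⟨α, hα0, fun t ht => (hα t (Set.Ioo_subset_Icc_self ht)).hasDerivAt
    (Icc_mem_nhds ht.1 ht.2)⟩

/-- The local solutions on the intervals `(-(n + 1), n + 1)` agree by uniqueness, and are glued. -/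
lemma exists_global_solution {f : ℝ → ℝ} {K L : NNReal} (hf : LipschitzWith K f)
    (hb : ∀ x, |f x| ≤ L) (x₀ : ℝ) :
    ∃ y : ℝ → ℝ, y 0 = x₀ ∧ ∀ t, HasDerivAt y (f (y t)) t := by
  choose α hα0 hα using exists_solution_on_Icc hf hb x₀
  have key : ∀ m n : ℕ, m ≤ n →
      Set.EqOn (α m) (α n) (Set.Ioo (-((m : ℝ) + 1)) ((m : ℝ) + 1)) := fun m n hmn => by
    have hm : (0 : ℝ) ≤ m := m.cast_nonneg
    have hmn' : (m : ℝ) ≤ n := Nat.cast_le.2 hmn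
    refine ODE_solution_unique_of_mem_Ioo (v := fun _ => f) (s := fun _ => Set.univ) (K := K)
      (t₀ := 0) (fun _ _ => hf.lipschitzOnWith) ⟨by linarith, by linarith⟩
      (fun t ht => ⟨hα m t ht, trivial⟩) (fun t ht => ⟨hα n t ⟨?_, ?_⟩, trivial⟩) ?_
    · linarith [ht.1]
    · linarith [ht.2]
    · rw [hα0, hα0]
  have hceil : ∀ t : ℝ, t ∈ Set.Ioo (-((⌈|t|⌉₊ : ℝ) + 1)) ((⌈|t|⌉₊ : ℝ) + 1) := fun t => by
    have := abs_le.1 (Nat.le_ceil |t|)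
    exact ⟨by linarith [this.1], by linarith [this.2]⟩
  have hy : ∀ n : ℕ, ∀ t ∈ Set.Ioo (-((n : ℝ) + 1)) ((n : ℝ) + 1), α ⌈|t|⌉₊ t = α n t :=
    fun n t ht => by
      rcases le_total n ⌈|t|⌉₊ with h | h
      · exact (key _ _ h ht).symm
      · exact key _ _ h (hceil t)
  refine ⟨fun t => α ⌈|t|⌉₊ t, by simp [hα0], fun t => ?_⟩
  refine (hα _ t (hceil t)).congr_of_eventuallyEq ?_
  filter_upwards [Ioo_mem_nhds (hceil t).1 (hceil t).2] with s hs
  exact hy _ s hs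

/-! ### The value curve -/

/-- `y` solves the equation `y' = lam * E (X - y)⁺` of the optimal value on `[0, ∞)`, with initial
value `m₀`. The values of `y` on the negative half-line only serve to have a continuous monotone
function on `ℝ` and two-sided derivatives. -/
structure IsValueCurve (ν : Measure ℝ) (lam m₀ : ℝ) (y : ℝ → ℝ) : Prop where
  zero : y 0 = m₀
  monotone : Monotone y
  continuous : Continuous y
  hasDerivAt : ∀ t, 0 ≤ t → HasDerivAt y (lam * excess ν (y t)) t

lemma exists_isValueCurve {ν : Measure ℝ} [IsProbabilityMeasure ν]
    (hν : Integrable (fun x : ℝ => max x 0) ν) {lam : ℝ} (hlam : 0 < lam) (m₀ : ℝ) :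
    ∃ y, IsValueCurve ν lam m₀ y := by
  -- The right-hand side is made bounded by freezing it below the level `m₀`.
  have hlip : LipschitzWith (Real.toNNReal lam * (1 * 1))
      (fun m => lam * excess ν (max m m₀)) := by
    refine LipschitzWith.of_dist_le_mul fun a b => ?_
    have h1 := ((lipschitzWith_excess hν).comp (LipschitzWith.id.max_const m₀)).dist_le_mul a b
    rw [Real.dist_eq] at h1 ⊢
    simp only [Function.comp_apply, id] at h1
    rw [← mul_sub, abs_mul, abs_of_pos hlam, NNReal.coe_mul, Real.coe_toNNReal _ hlam.le, mul_assoc]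
    exact mul_le_mul_of_nonneg_left h1 hlam.le
  have hnn : ∀ m, 0 ≤ lam * excess ν (max m m₀) := fun m =>
    mul_nonneg hlam.le (excess_nonneg _)
  have hb : ∀ m, |lam * excess ν (max m m₀)| ≤
      ((⟨lam * excess ν m₀, mul_nonneg hlam.le (excess_nonneg _)⟩ : NNReal) : ℝ) := fun m => by
    rw [abs_of_nonneg (hnn m)]
    exact mul_le_mul_of_nonneg_left (excess_antitone hν (le_max_right _ _)) hlam.le
  obtain ⟨y, hy0, hy⟩ := exists_global_solution hlip hb m₀
  have hmono : Monotone y := monotone_of_hasDerivAt_nonneg hy fun t => hnn _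
  refine ⟨y, hy0, hmono, continuous_iff_continuousAt.2 fun t => (hy t).continuousAt,
    fun t ht => ?_⟩
  have h := hy t
  rwa [max_eq_left (hy0 ▸ hmono ht)] at h

section ValueCurve

variable {ν : Measure ℝ} [IsProbabilityMeasure ν] {lam m₀ : ℝ} {y : ℝ → ℝ}

/-- The derivative of the value curve on `[0, ∞)`, as a function on `ℝ`. -/
noncomputable def speed (ν : Measure ℝ) (lam : ℝ) (y : ℝ → ℝ) (t : ℝ) : ℝ := lam * excess ν (y t)

lemma continuous_speed (hν : Integrable (fun x : ℝ => max x 0) ν) (hy : IsValueCurve ν lam m₀ y) :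
    Continuous (speed ν lam y) :=
  continuous_const.mul ((lipschitzWith_excess hν).continuous.comp hy.continuous)

lemma speed_antitone (hν : Integrable (fun x : ℝ => max x 0) ν) (hlam : 0 < lam)
    (hy : IsValueCurve ν lam m₀ y) : Antitone (speed ν lam y) := fun _ _ hab =>
  mul_le_mul_of_nonneg_left (excess_antitone hν (hy.monotone hab)) hlam.le

lemma hasDerivWithinAt_speed (hν : Integrable (fun x : ℝ => max x 0) ν)
    (hy : IsValueCurve ν lam m₀ y) {t : ℝ} (ht : 0 ≤ t) :
    HasDerivWithinAt (speed ν lam y) (-(lam * ν.real (Set.Ioi (y t)) * speed ν lam y t))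
      (Set.Ioi t) t := by
  have h := ((hasDerivWithinAt_excess hν (y t)).comp t (hy.hasDerivAt t ht).hasDerivWithinAt
    (fun s hs => hy.monotone hs : Set.MapsTo y (Set.Ici t) (Set.Ici (y t)))).const_mul lam
  have h' := hasDerivWithinAt_Ioi_iff_Ici.2 h
  convert! h' using 1
  rw [speed]; ring

lemma hasDerivAt_exp_const_mul (lam t : ℝ) :
    HasDerivAt (fun t => Real.exp (lam * t)) (lam * Real.exp (lam * t)) t := by
  have := ((hasDerivAt_id t).const_mul lam).exp
  simpa [mul_comm] using this

lemma measurable_real_Iic_comp (hy : Measurable y) :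
    Measurable fun r => ν.real (Set.Iic (y r)) := by
  simp_rw [← cdf_eq_real]
  exact (monotone_cdf ν).measurable.comp hy

/-- The linear equation `speed' = -lam * P (X > y) * speed` for the right derivative, integrated
with the integrating factor `exp (lam * r)`. -/
lemma integral_exp_mul_speed (hν : Integrable (fun x : ℝ => max x 0) ν)
    (hy : IsValueCurve ν lam m₀ y) {a b : ℝ} (ha : 0 ≤ a) (hab : a ≤ b) :
    IntervalIntegrable
      (fun r => lam * Real.exp (lam * r) * (ν.real (Set.Iic (y r)) * speed ν lam y r))
      volume a b ∧
    ∫ r in a..b, lam * Real.exp (lam * r) * (ν.real (Set.Iic (y r)) * speed ν lam y r)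
      = Real.exp (lam * b) * speed ν lam y b - Real.exp (lam * a) * speed ν lam y a := by
  have hc := continuous_speed hν hy
  have hint : IntervalIntegrable
      (fun r => lam * Real.exp (lam * r) * (ν.real (Set.Iic (y r)) * speed ν lam y r))
      volume a b := by
    have hcont : Continuous fun r => lam * Real.exp (lam * r) * speed ν lam y r := by fun_prop
    refine (hcont.intervalIntegrable a b).mono_fun ?_ (ae_of_all _ fun r => ?_)
    · exact ((by fun_prop : Measurable fun r => lam * Real.exp (lam * r)).mul
        ((measurable_real_Iic_comp hy.continuous.measurable).mul
          hc.measurable)).aestronglyMeasurable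
    · beta_reduce
      rw [norm_mul, norm_mul (ν.real _), norm_mul (lam * Real.exp (lam * r)) (speed ν lam y r)]
      refine mul_le_mul_of_nonneg_left ?_ (norm_nonneg _)
      refine mul_le_of_le_one_left (norm_nonneg _) ?_
      rw [Real.norm_of_nonneg measureReal_nonneg]
      exact measureReal_le_one
  refine ⟨hint, ?_⟩
  refine intervalIntegral.integral_eq_sub_of_hasDeriv_right_of_le hab
    (f := fun r => Real.exp (lam * r) * speed ν lam y r) (by fun_prop) (fun r hr => ?_) hint
  have hr0 : 0 ≤ r := ha.trans hr.1.le
  have h := (hasDerivAt_exp_const_mul lam r).hasDerivWithinAt (s := Set.Ioi r) |>.mul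
    (hasDerivWithinAt_speed hν hy hr0)
  convert! h using 1
  have := probReal_compl_eq_one_sub (μ := ν) (measurableSet_Iic (a := y r))
  rw [Set.compl_Iic] at this
  rw [this]; ring

lemma exp_mul_speed_le (hν : Integrable (fun x : ℝ => max x 0) ν) (hlam : 0 < lam)
    (hy : IsValueCurve ν lam m₀ y) {a b : ℝ} (ha : 0 ≤ a) (hab : a ≤ b) :
    Real.exp (lam * a) * speed ν lam y a ≤ Real.exp (lam * b) * speed ν lam y b := by
  rw [← sub_nonneg, ← (integral_exp_mul_speed hν hy ha hab).2]
  exact intervalIntegral.integral_nonneg hab fun r _ => mul_nonneg (by positivity)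
    (mul_nonneg measureReal_nonneg (mul_nonneg hlam.le (excess_nonneg _)))

/-- The value curve never reaches the upper end of the support of the offers. -/
lemma speed_pos (hν : Integrable (fun x : ℝ => max x 0) ν) (hlam : 0 < lam)
    (hm₀ : (m₀ : EReal) < supSupport ν) (hy : IsValueCurve ν lam m₀ y) {t : ℝ} (ht : 0 ≤ t) :
    0 < speed ν lam y t := by
  have h0 : 0 < Real.exp (lam * 0) * speed ν lam y 0 := by
    rw [speed, hy.zero]
    exact mul_pos (Real.exp_pos _) (mul_pos hlam (excess_pos_of_lt_supSupport hν hm₀))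
  exact pos_of_mul_pos_right (h0.trans_le (exp_mul_speed_le hν hlam hy le_rfl ht))
    (Real.exp_pos _).le

lemma strictMonoOn_valueCurve (hν : Integrable (fun x : ℝ => max x 0) ν) (hlam : 0 < lam)
    (hm₀ : (m₀ : EReal) < supSupport ν) (hy : IsValueCurve ν lam m₀ y) :
    StrictMonoOn y (Set.Ici 0) := by
  refine strictMonoOn_of_deriv_pos (convex_Ici 0) hy.continuous.continuousOn fun t ht => ?_
  rw [interior_Ici] at ht
  rw [(hy.hasDerivAt t (le_of_lt ht)).deriv]
  exact speed_pos hν hlam hm₀ hy (le_of_lt ht)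

/-- The value curve meets the countably many atoms of `ν` only at countably many times. -/
lemma ae_Iio_eq_Iic (hν : Integrable (fun x : ℝ => max x 0) ν) (hlam : 0 < lam)
    (hm₀ : (m₀ : EReal) < supSupport ν) (hy : IsValueCurve ν lam m₀ y) :
    ∀ᵐ r, 0 ≤ r → ν (Set.Iio (y r)) = ν (Set.Iic (y r)) := by
  have hcount : {x : ℝ | ν {x} ≠ 0}.Countable := by
    have := Measure.countable_meas_pos_of_disjoint_iUnion (μ := ν) (As := fun x : ℝ => {x})
      (fun x => measurableSet_singleton x) (fun a b hab => by simpa using hab)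
    simpa [pos_iff_ne_zero] using this
  have hpre : {r : ℝ | 0 ≤ r ∧ ν {y r} ≠ 0}.Countable :=
    (Set.MapsTo.countable_of_injOn (f := y) (fun r hr => hr.2)
      ((strictMonoOn_valueCurve hν hlam hm₀ hy).injOn.mono fun r hr => hr.1) hcount)
  filter_upwards [hpre.ae_notMem volume] with r hr hr0
  have h0 : ν {y r} = 0 := by
    by_contra h
    exact hr ⟨hr0, h⟩
  rw [← Set.Iio_union_right]
  exact le_antisymm (measure_mono Set.subset_union_left)
    ((measure_union_le _ _).trans (by rw [h0, add_zero]))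

lemma integral_exp_mul_valueCurve (hν : Integrable (fun x : ℝ => max x 0) ν)
    (hy : IsValueCurve ν lam m₀ y) {s : ℝ} (hs : 0 ≤ s) :
    ∫ r in 0..s, lam * Real.exp (lam * r) * (y r + excess ν (y r))
      = Real.exp (lam * s) * y s - m₀ := by
  have hcont : Continuous fun r => lam * Real.exp (lam * r) * (y r + excess ν (y r)) := by
    have := hy.continuous
    have := (lipschitzWith_excess hν).continuous.comp hy.continuous
    fun_prop
  have := intervalIntegral.integral_eq_sub_of_hasDerivAt
    (f := fun r => Real.exp (lam * r) * y r) (a := 0) (b := s)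
    (f' := fun r => lam * Real.exp (lam * r) * (y r + excess ν (y r)))
    (fun r hr => by
      rw [Set.uIcc_of_le hs] at hr
      convert! (hasDerivAt_exp_const_mul lam r).mul (hy.hasDerivAt r hr.1) using 1
      ring) (hcont.intervalIntegrable _ _)
  rw [this, hy.zero]
  simp

end ValueCurve

/-! ### Regular variation of positive antitone functions -/

lemma tendsto_const_mul_atTop_atTop {x : ℝ} (hx : 0 < x) :
    Tendsto (fun t : ℝ => x * t) atTop atTop :=
  tendsto_id.const_mul_atTop hx

/-- If `q (x * t) / q t` has a positive limit for each `x > 0`, then the limit is multiplicative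
in `x` and monotone, hence a power. -/
lemma exists_rpow_of_tendsto_ratio {q : ℝ → ℝ} (hq : Antitone q) (hpos : ∀ t, 0 ≤ t → 0 < q t)
    (h : ∀ x, 0 < x → ∃ l, 0 < l ∧ Tendsto (fun t => q (x * t) / q t) atTop (𝓝 l)) :
    ∃ ρ : ℝ, ρ ≤ 0 ∧ ∀ x, 0 < x → Tendsto (fun t => q (x * t) / q t) atTop (𝓝 (x ^ ρ)) := by
  choose! L hLpos hL using h
  have hmul : ∀ x z, 0 < x → 0 < z → L (x * z) = L x * L z := fun x z hx hz => by
    refine tendsto_nhds_unique (hL _ (mul_pos hx hz)) ?_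
    refine (((hL x hx).comp (tendsto_const_mul_atTop_atTop hz)).mul (hL z hz)).congr' ?_
    filter_upwards [eventually_ge_atTop 0] with t ht
    have h1 : q (z * t) ≠ 0 := (hpos _ (mul_nonneg hz.le ht)).ne'
    rw [Function.comp_apply, div_mul_div_cancel₀ h1, mul_assoc]
  have hanti : ∀ x z, 0 < x → x ≤ z → L z ≤ L x := fun x z hx hxz => by
    refine le_of_tendsto_of_tendsto (hL z (hx.trans_le hxz)) (hL x hx) ?_
    filter_upwards [eventually_ge_atTop 0] with t ht
    exact div_le_div_of_nonneg_right (hq (mul_le_mul_of_nonneg_right hxz ht)) (hpos t ht).le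
  have hone : L 1 = 1 := by
    have := hmul 1 1 one_pos one_pos
    rw [one_mul] at this
    exact (mul_eq_left₀ (hLpos 1 one_pos).ne').1 this.symm
  -- In logarithmic coordinates the limit is an additive function, which is linear.
  let f : ℝ →+ ℝ :=
    { toFun := fun u => Real.log (L (Real.exp u))
      map_zero' := by simp [hone]
      map_add' := fun u v => by
        rw [Real.exp_add, hmul _ _ (Real.exp_pos u) (Real.exp_pos v),
          Real.log_mul (hLpos _ (Real.exp_pos u)).ne' (hLpos _ (Real.exp_pos v)).ne'] }
  have hfanti : Antitone f := fun u v huv =>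
    Real.log_le_log (hLpos _ (Real.exp_pos v)) (hanti _ _ (Real.exp_pos u) (Real.exp_le_exp.2 huv))
  have hcont : Continuous f :=
    MeasureTheory.Measure.AddMonoidHom.continuous_of_measurable f hfanti.measurable
  refine ⟨f 1, ?_, fun x hx => ?_⟩
  · have := hfanti (zero_le_one' ℝ)
    rwa [map_zero] at this
  · have hlin : f (Real.log x) = Real.log x * f 1 := by
      have := map_real_smul f hcont (Real.log x) 1
      simpa using this
    have hval : f (Real.log x) = Real.log (L x) := by
      change Real.log (L (Real.exp (Real.log x))) = _
      rw [Real.exp_log hx]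
    rw [Real.rpow_def_of_pos hx, ← hlin, hval, Real.exp_log (hLpos x hx)]
    exact hL x hx

/-- Right-continuity of the limiting distribution function at `0` excludes rapid variation: if the
limit of `q t / q (x * t)` vanished at some `x < 1`, it would vanish at all roots of `x`. -/
lemma exists_rpow_of_tendsto_cdf {q : ℝ → ℝ} (hq : Antitone q) (hpos : ∀ t, 0 ≤ t → 0 < q t)
    {κ : Measure ℝ} [IsProbabilityMeasure κ]
    (h : ∀ s, 0 ≤ s → s < 1 →
      Tendsto (fun t => 1 - q t / q ((1 - s) * t)) atTop (𝓝 (cdf κ s))) :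
    ∃ ρ : ℝ, ρ ≤ 0 ∧ ∀ x, 0 < x → Tendsto (fun t => q (x * t) / q t) atTop (𝓝 (x ^ ρ)) := by
  set H : ℝ → ℝ := fun x => 1 - cdf κ (1 - x) with hH
  have hlim : ∀ x, 0 < x → x ≤ 1 → Tendsto (fun t => q t / q (x * t)) atTop (𝓝 (H x)) :=
    fun x hx hx1 => by
      have := (h (1 - x) (by linarith) (by linarith)).const_sub 1
      simpa using this
  have hmul : ∀ x z, 0 < x → x ≤ 1 → 0 < z → z ≤ 1 → H (x * z) = H x * H z :=
    fun x z hx hx1 hz hz1 => by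
      refine tendsto_nhds_unique (hlim _ (mul_pos hx hz) (mul_le_one₀ hx1 hz.le hz1)) ?_
      refine (((hlim x hx hx1).comp (tendsto_const_mul_atTop_atTop hz)).mul
        (hlim z hz hz1)).congr' ?_
      filter_upwards [eventually_ge_atTop 0] with t ht
      have h1 : q (z * t) ≠ 0 := (hpos _ (mul_nonneg hz.le ht)).ne'
      rw [Function.comp_apply, mul_comm, div_mul_div_cancel₀ h1, mul_assoc]
  have hpow : ∀ z, 0 < z → z ≤ 1 → ∀ n : ℕ, H (z ^ (n + 1)) = H z ^ (n + 1) := fun z hz hz1 n => by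
    induction n with
    | zero => simp
    | succ n ih =>
      rw [pow_succ, hmul _ _ (pow_pos hz _) (pow_le_one₀ hz.le hz1) hz hz1, ih, pow_succ _ (n + 1)]
  have hone : H 1 = 1 := by
    refine tendsto_nhds_unique (hlim 1 one_pos le_rfl) (tendsto_const_nhds.congr' ?_)
    filter_upwards [eventually_ge_atTop 0] with t ht
    rw [one_mul, div_self (hpos t ht).ne']
  have hHpos : ∀ x, 0 < x → x ≤ 1 → 0 < H x := fun x hx hx1 => by
    refine lt_of_le_of_ne (sub_nonneg.2 (cdf_le_one κ _)) fun h0 => ?_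
    have hroot : ∀ n : ℕ, H (x ^ (1 / ((n : ℝ) + 1))) = 0 := fun n => by
      have := hpow (x ^ (1 / ((n : ℝ) + 1))) (Real.rpow_pos_of_pos hx _)
        (Real.rpow_le_one hx.le hx1 (by positivity)) n
      rw [← Real.rpow_natCast, ← Real.rpow_mul hx.le, Nat.cast_succ,
        one_div_mul_cancel (by positivity), Real.rpow_one, ← h0] at this
      exact pow_eq_zero_iff (n.succ_ne_zero) |>.1 this.symm
    have hz : Tendsto (fun n : ℕ => 1 - x ^ (1 / ((n : ℝ) + 1))) atTop (𝓝[≥] 0) := by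
      refine tendsto_nhdsWithin_iff.2 ⟨?_, Eventually.of_forall fun n => ?_⟩
      · have := (Real.continuousAt_const_rpow (b := (0 : ℝ)) hx.ne').tendsto.comp
          tendsto_one_div_add_atTop_nhds_zero_nat
        simpa using this.const_sub 1
      · exact sub_nonneg.2 (Real.rpow_le_one hx.le hx1 (by positivity))
    have hcdf := ((cdf κ).right_continuous 0).tendsto.comp hz
    have h1 : (cdf κ) 0 = 1 := by
      refine tendsto_nhds_unique hcdf (tendsto_const_nhds.congr fun n => ?_)
      have := hroot n
      simp only [hH] at this
      rw [Function.comp_apply]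
      linarith
    simp only [hH, sub_self, h1] at hone
    exact zero_ne_one hone
  refine exists_rpow_of_tendsto_ratio hq hpos fun x hx => ?_
  rcases le_total x 1 with hx1 | hx1
  · refine ⟨(H x)⁻¹, inv_pos.2 (hHpos x hx hx1), ?_⟩
    simpa using (hlim x hx hx1).inv₀ (hHpos x hx hx1).ne'
  · have hx' := inv_pos.2 hx
    have hx1' := inv_le_one_of_one_le₀ hx1
    refine ⟨H x⁻¹, hHpos _ hx' hx1', ?_⟩
    refine ((hlim _ hx' hx1').comp (tendsto_const_mul_atTop_atTop hx)).congr fun t => ?_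
    rw [Function.comp_apply, inv_mul_cancel_left₀ hx.ne']

/-- The limit law: the Beta distribution with parameters `1, γ`, which is the point mass at `1` for
`γ = 0`. -/
lemma exists_cdf_eq_one_sub_rpow {γ : ℝ} (hγ : 0 ≤ γ) :
    ∃ κ : Measure ℝ, IsProbabilityMeasure κ ∧
      ∀ s, 0 ≤ s → cdf κ s = if s < 1 then 1 - (1 - s) ^ γ else 1 := by
  rcases hγ.eq_or_lt with rfl | hγ
  · refine ⟨Measure.dirac 1, inferInstance, fun s _ => ?_⟩
    rw [cdf_eq_real, measureReal_def, Measure.dirac_apply' _ measurableSet_Iic]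
    by_cases hs : s < 1
    · simp [hs]
    · simp [hs, not_lt.1 hs]
  · let f : StieltjesFunction ℝ :=
      { toFun := fun s => 1 - (max 0 (min 1 (1 - s))) ^ γ
        mono' := fun a b hab => sub_le_sub_left (Real.rpow_le_rpow (le_max_left _ _)
          (max_le_max le_rfl (min_le_min le_rfl (by linarith))) hγ.le) _
        right_continuous' := fun s => by
          have : Continuous fun s : ℝ => 1 - (max 0 (min 1 (1 - s))) ^ γ :=
            continuous_const.sub ((Real.continuous_rpow_const hγ.le).comp (by fun_prop))
          exact this.continuousWithinAt }
    have hf0 : Tendsto f atBot (𝓝 0) := by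
      refine tendsto_const_nhds.congr' ?_
      filter_upwards [eventually_le_atBot 0] with s hs
      change 0 = 1 - (max 0 (min 1 (1 - s))) ^ γ
      rw [min_eq_left (by linarith), max_eq_right zero_le_one, Real.one_rpow, sub_self]
    have hf1 : Tendsto f atTop (𝓝 1) := by
      refine tendsto_const_nhds.congr' ?_
      filter_upwards [eventually_ge_atTop 1] with s hs
      change 1 = 1 - (max 0 (min 1 (1 - s))) ^ γ
      rw [max_eq_left (min_le_of_right_le (by linarith)), Real.zero_rpow hγ.ne', sub_zero]
    refine ⟨f.measure, ⟨by rw [f.measure_univ hf0 hf1, sub_zero, ENNReal.ofReal_one]⟩,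
      fun s hs => ?_⟩
    rw [cdf_measure_stieltjesFunction f hf0 hf1]
    change 1 - (max 0 (min 1 (1 - s))) ^ γ = _
    split_ifs with hs1
    · rw [min_eq_right (by linarith), max_eq_right (by linarith)]
    · rw [max_eq_left (min_le_of_right_le (by linarith)), Real.zero_rpow hγ.ne', sub_zero]

lemma tendsto_div_of_tendsto_ratio {q : ℝ → ℝ} {γ x : ℝ} (hx : 0 < x)
    (h : Tendsto (fun t => q (x * t) / q t) atTop (𝓝 (x ^ (-γ)))) :
    Tendsto (fun t => q t / q (x * t)) atTop (𝓝 (x ^ γ)) := by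
  have := h.inv₀ (Real.rpow_pos_of_pos hx _).ne'
  rw [Real.rpow_neg hx.le, inv_inv] at this
  simpa using this

/-! ### First stopping steps -/

section Pathwise

variable {A : Set (ℝ × ℝ)} {t : ℝ} {d x : ℕ → ℝ}

lemma remaining_succ_nonneg (n : ℕ) : 0 ≤ remaining d t (n + 1) := le_max_right _ _

lemma remaining_nonneg (ht : 0 ≤ t) : ∀ n, 0 ≤ remaining d t n
  | 0 => ht
  | _ + 1 => remaining_succ_nonneg _

lemma remaining_le (ht : 0 ≤ t) (hd : ∀ n, 0 ≤ d n) : ∀ n, remaining d t n ≤ t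
  | 0 => le_rfl
  | n + 1 => max_le (by linarith [remaining_le ht hd n, hd n]) ht

/-- Step `n` is the first one at which the process stops. -/
def FirstStopsAt (A : Set (ℝ × ℝ)) (t : ℝ) (d x : ℕ → ℝ) (n : ℕ) : Prop :=
  (∀ k < n, ¬ StopsAt A t d x k) ∧ StopsAt A t d x n

lemma FirstStopsAt.salePrice_eq {n : ℕ} (h : FirstStopsAt A t d x n) (x₀ : ℝ) :
    salePrice A t d x x₀ = if remaining d t (n + 1) = 0 then x₀ else x n := by
  classical
  have hex : ∃ n, StopsAt A t d x n := ⟨n, h.2⟩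
  have hfind : Nat.find hex = n := (Nat.find_eq_iff hex).2 ⟨h.2, h.1⟩
  rw [salePrice, dif_pos hex]
  convert rfl using 2 <;> rw [← hfind]

lemma FirstStopsAt.timeToSale_eq {n : ℕ} (h : FirstStopsAt A t d x n) :
    timeToSale A t d x = t - remaining d t (n + 1) := by
  classical
  have hex : ∃ n, StopsAt A t d x n := ⟨n, h.2⟩
  have hfind : Nat.find hex = n := (Nat.find_eq_iff hex).2 ⟨h.2, h.1⟩
  rw [timeToSale, dif_pos hex]
  convert rfl using 3
  rw [← hfind]

lemma salePrice_of_forall_not (h : ∀ n, ¬ StopsAt A t d x n) (x₀ : ℝ) :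
    salePrice A t d x x₀ = x₀ := dif_neg (not_exists.2 h)

lemma timeToSale_of_forall_not (h : ∀ n, ¬ StopsAt A t d x n) :
    timeToSale A t d x = t := dif_neg (not_exists.2 h)

lemma exists_firstStopsAt_of_exists (h : ∃ n, StopsAt A t d x n) :
    ∃ n, FirstStopsAt A t d x n := by
  classical
  exact ⟨Nat.find h, fun _ hk => Nat.find_min h hk, Nat.find_spec h⟩

lemma FirstStopsAt.unique {m n : ℕ} (hm : FirstStopsAt A t d x m) (hn : FirstStopsAt A t d x n) :
    m = n := by
  rcases lt_trichotomy m n with h | h | h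
  · exact absurd hm.2 (hn.1 m h)
  · exact h
  · exact absurd hn.2 (hm.1 n h)

lemma salePrice_eq_add (A : Set (ℝ × ℝ)) (t : ℝ) (d x : ℕ → ℝ) (x₀ m : ℝ) :
    salePrice A t d x x₀ = salePrice A t d x m
      + (salePrice A t d x 1 - salePrice A t d x 0) * (x₀ - m) := by
  simp only [salePrice]
  split_ifs <;> ring

lemma abs_salePrice_one_sub_zero_le (A : Set (ℝ × ℝ)) (t : ℝ) (d x : ℕ → ℝ) :
    |salePrice A t d x 1 - salePrice A t d x 0| ≤ 1 := by
  simp only [salePrice]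
  split_ifs <;> simp

/-- Only the decisions of a policy at nonnegative remaining times matter. -/
lemma timeToSale_congr {A B : Set (ℝ × ℝ)}
    (h : ∀ r x, 0 ≤ r → ((r, x) ∈ A ↔ (r, x) ∈ B)) (t : ℝ) (d x : ℕ → ℝ) :
    timeToSale A t d x = timeToSale B t d x := by
  have hs : StopsAt A t d x = StopsAt B t d x := by
    ext n
    rw [StopsAt, StopsAt, h _ _ (remaining_succ_nonneg n)]
  by_cases hex : ∃ n, StopsAt A t d x n
  · obtain ⟨n, hn⟩ := exists_firstStopsAt_of_exists hex
    have hn' : FirstStopsAt B t d x n := by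
      rwa [FirstStopsAt, ← hs]
    rw [hn.timeToSale_eq, hn'.timeToSale_eq]
  · have hex' := not_exists.1 hex
    rw [timeToSale_of_forall_not hex', timeToSale_of_forall_not (hs ▸ hex')]

end Pathwise

section Measurability

variable {Ω : Type*} {m : MeasurableSpace Ω} {D X : ℕ → Ω → ℝ} {A : Set (ℝ × ℝ)} {t : ℝ}

lemma measurable_remaining {n : ℕ} (hD : ∀ k < n, Measurable (D k)) :
    Measurable fun ω => remaining (fun k => D k ω) t n := by
  induction n with
  | zero => exact measurable_const
  | succ n ih =>
    exact ((ih fun k hk => hD k (hk.trans n.lt_succ_self)).sub (hD n n.lt_succ_self)).max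
      measurable_const

lemma measurableSet_stopsAt (hA : MeasurableSet A) {n : ℕ} (hD : ∀ k ≤ n, Measurable (D k))
    (hX : Measurable (X n)) :
    MeasurableSet {ω | StopsAt A t (fun k => D k ω) (fun k => X k ω) n} := by
  have hr : Measurable fun ω => remaining (fun k => D k ω) t (n + 1) :=
    measurable_remaining fun k hk => hD k (Nat.lt_succ_iff.1 hk)
  exact (hr (measurableSet_singleton 0)).union ((hr.prodMk hX) hA)

lemma measurableSet_forall_not_stopsAt (hA : MeasurableSet A) {n : ℕ}
    (hD : ∀ k < n, Measurable (D k)) (hX : ∀ k < n, Measurable (X k)) :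
    MeasurableSet {ω | ∀ k < n, ¬ StopsAt A t (fun k => D k ω) (fun k => X k ω) k} := by
  simp only [Set.ofPred_forall]
  exact MeasurableSet.iInter fun k => MeasurableSet.iInter fun hk =>
    (measurableSet_stopsAt hA (fun j hj => hD j (hj.trans_lt hk)) (hX k hk)).compl

lemma measurableSet_firstStopsAt (hA : MeasurableSet A) (hD : ∀ k, Measurable (D k))
    (hX : ∀ k, Measurable (X k)) (n : ℕ) :
    MeasurableSet {ω | FirstStopsAt A t (fun k => D k ω) (fun k => X k ω) n} :=
  (measurableSet_forall_not_stopsAt hA (fun k _ => hD k) fun k _ => hX k).inter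
    (measurableSet_stopsAt hA (fun k _ => hD k) (hX n))

/-- A function given by a measurable formula on each first-stopping event, and on the event that the
process does not stop, is measurable. -/
lemma measurable_of_firstStopsAt {β : Type*} [MeasurableSpace β] (hA : MeasurableSet A)
    (hD : ∀ k, Measurable (D k)) (hX : ∀ k, Measurable (X k)) {f W : Ω → β} {Z : ℕ → Ω → β}
    (hZ : ∀ n, Measurable (Z n)) (hW : Measurable W)
    (hfZ : ∀ n ω, FirstStopsAt A t (fun k => D k ω) (fun k => X k ω) n → f ω = Z n ω)
    (hfW : ∀ ω, (∀ n, ¬ StopsAt A t (fun k => D k ω) (fun k => X k ω) n) → f ω = W ω) :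
    Measurable f := by
  intro s hs
  have hN : MeasurableSet {ω | ∀ n, ¬ StopsAt A t (fun k => D k ω) (fun k => X k ω) n} := by
    simp only [Set.ofPred_forall]
    exact MeasurableSet.iInter fun k => (measurableSet_stopsAt hA (fun j _ => hD j) (hX k)).compl
  have : f ⁻¹' s = (⋃ n, {ω | FirstStopsAt A t (fun k => D k ω) (fun k => X k ω) n} ∩ Z n ⁻¹' s) ∪
      ({ω | ∀ n, ¬ StopsAt A t (fun k => D k ω) (fun k => X k ω) n} ∩ W ⁻¹' s) := by
    ext ω
    simp only [Set.mem_preimage, Set.mem_union, Set.mem_iUnion, Set.mem_inter_iff, Set.mem_ofPred]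
    constructor
    · intro h
      by_cases hex : ∃ n, StopsAt A t (fun k => D k ω) (fun k => X k ω) n
      · obtain ⟨n, hn⟩ := exists_firstStopsAt_of_exists hex
        exact Or.inl ⟨n, hn, hfZ n ω hn ▸ h⟩
      · exact Or.inr ⟨not_exists.1 hex, hfW ω (not_exists.1 hex) ▸ h⟩
    · rintro (⟨n, hn, h⟩ | ⟨hn, h⟩)
      · exact (hfZ n ω hn).symm ▸ h
      · exact (hfW ω hn).symm ▸ h
  rw [this]
  exact (MeasurableSet.iUnion fun n =>
    (measurableSet_firstStopsAt hA hD hX n).inter (hZ n hs)).union (hN.inter (hW hs))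

lemma measurable_salePrice (hA : MeasurableSet A) (hD : ∀ k, Measurable (D k))
    (hX : ∀ k, Measurable (X k)) {X₀ : Ω → ℝ} (hX₀ : Measurable X₀) :
    Measurable fun ω => salePrice A t (fun k => D k ω) (fun k => X k ω) (X₀ ω) :=
  measurable_of_firstStopsAt hA hD hX
    (fun n => Measurable.ite ((measurable_remaining (n := n + 1) fun k _ => hD k)
      (measurableSet_singleton 0)) hX₀ (hX n)) hX₀
    (fun _ _ h => h.salePrice_eq _) fun _ h => salePrice_of_forall_not h _

lemma measurable_timeToSale (hA : MeasurableSet A) (hD : ∀ k, Measurable (D k))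
    (hX : ∀ k, Measurable (X k)) :
    Measurable fun ω => timeToSale A t (fun k => D k ω) (fun k => X k ω) :=
  measurable_of_firstStopsAt hA hD hX
    (fun n => (measurable_const (a := t)).sub (measurable_remaining (n := n + 1) fun k _ => hD k))
    measurable_const (fun _ _ h => h.timeToSale_eq) fun _ h => timeToSale_of_forall_not h

end Measurability

/-! ### Conditioning on the past -/

lemma expMeasure_Ici {lam : ℝ} (hlam : 0 < lam) {s : ℝ} (hs : 0 ≤ s) :
    expMeasure lam (Set.Ici s) = ENNReal.ofReal (Real.exp (-(lam * s))) := by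
  have := isProbabilityMeasure_expMeasure hlam
  have hs0 : expMeasure lam {s} = 0 :=
    withDensity_absolutelyContinuous volume (gammaPDF 1 lam) Real.volume_singleton
  rw [← ofReal_measureReal, measureReal_congr (Ioi_ae_eq_Ici' hs0).symm, ← Set.compl_Iic,
    probReal_compl_eq_one_sub measurableSet_Iic, ← cdf_eq_real, cdf_expMeasure_eq hlam, if_pos hs,
    sub_sub_cancel]

/-- If `Z` is independent of a σ-algebra, then a quantity measurable with respect to it can be
frozen when `Z` is averaged. -/
lemma setLIntegral_comp_of_indep {Ω β : Type*} {m₁ mΩ : MeasurableSpace Ω} [MeasurableSpace β]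
    {P : Measure Ω} [IsProbabilityMeasure P] (hm₁ : m₁ ≤ mΩ) {Z : Ω → β}
    (hZ : Measurable Z) (hind : Indep m₁ (MeasurableSpace.comap Z inferInstance) P)
    {S : Ω → ℝ} (hS : Measurable[m₁] S) {N : Set Ω} (hN : MeasurableSet[m₁] N)
    {F : ℝ → β → ENNReal} (hF : Measurable (Function.uncurry F)) :
    ∫⁻ ω in N, F (S ω) (Z ω) ∂P = ∫⁻ ω in N, ∫⁻ z, F (S ω) z ∂(P.map Z) ∂P := by
  let Y : Ω → ℝ × ENNReal := fun ω => (S ω, N.indicator 1 ω)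
  have hY₁ : Measurable[m₁] Y := hS.prodMk
    (Measurable.indicator (@measurable_const _ _ _ m₁ 1) hN)
  have hY : Measurable Y := hY₁.mono hm₁ le_rfl
  have hYZ : IndepFun Y Z P := indep_of_indep_of_le_left hind hY₁.comap_le
  have hprod := hYZ.map_prod_eq_prod_map_map hY.aemeasurable hZ.aemeasurable
  have : IsProbabilityMeasure (P.map Z) := Measure.isProbabilityMeasure_map hZ.aemeasurable
  have : IsProbabilityMeasure (P.map Y) := Measure.isProbabilityMeasure_map hY.aemeasurable
  have hG : Measurable fun p : (ℝ × ENNReal) × β => p.1.2 * F p.1.1 p.2 :=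
    (measurable_snd.comp measurable_fst).mul
      (hF.comp ((measurable_fst.comp measurable_fst).prodMk measurable_snd))
  have hFS : ∀ s, Measurable (F s) := fun s => hF.comp measurable_prodMk_left
  have hind1 : ∀ f : Ω → ENNReal, ∫⁻ ω in N, f ω ∂P = ∫⁻ ω, N.indicator 1 ω * f ω ∂P :=
    fun f => by
      rw [← lintegral_indicator (hm₁ _ hN)]
      refine lintegral_congr fun ω => ?_
      by_cases h : ω ∈ N <;> simp [h]
  rw [hind1, hind1]
  calc ∫⁻ ω, N.indicator 1 ω * F (S ω) (Z ω) ∂P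
      = ∫⁻ p, p.1.2 * F p.1.1 p.2 ∂(P.map fun ω => (Y ω, Z ω)) :=
        (lintegral_map hG (hY.prodMk hZ)).symm
    _ = ∫⁻ w, ∫⁻ z, w.2 * F w.1 z ∂(P.map Z) ∂(P.map Y) := by
        rw [hprod, lintegral_prod _ hG.aemeasurable]
    _ = ∫⁻ w, w.2 * ∫⁻ z, F w.1 z ∂(P.map Z) ∂(P.map Y) :=
        lintegral_congr fun w => lintegral_const_mul _ (hFS _)
    _ = _ := by
        have hI : Measurable fun s => ∫⁻ z, F s z ∂(P.map Z) := hF.lintegral_prod_right'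
        exact lintegral_map (f := fun w : ℝ × ENNReal => w.2 * ∫⁻ z, F w.1 z ∂(P.map Z))
          (measurable_snd.mul (hI.comp measurable_fst)) hY

section Family

variable {Ω : Type*} {D X : ℕ → Ω → ℝ} {X₀ : Ω → ℝ}

/-- The variables of the process, as one family. -/
abbrev allVars (D X : ℕ → Ω → ℝ) (X₀ : Ω → ℝ) : ℕ ⊕ ℕ ⊕ Unit → Ω → ℝ :=
  Sum.elim D (Sum.elim X fun _ => X₀)

/-- The σ-algebra generated by the variables with indices in `I`. -/
abbrev sigmaOf (D X : ℕ → Ω → ℝ) (X₀ : Ω → ℝ) (I : Set (ℕ ⊕ ℕ ⊕ Unit)) : MeasurableSpace Ω :=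
  ⨆ i ∈ I, MeasurableSpace.comap (allVars D X X₀ i) inferInstance

lemma measurable_sigmaOf {I : Set (ℕ ⊕ ℕ ⊕ Unit)} {i : ℕ ⊕ ℕ ⊕ Unit} (hi : i ∈ I) :
    Measurable[sigmaOf D X X₀ I] (allVars D X X₀ i) :=
  Measurable.of_comap_le (le_iSup₂ (f := fun i _ =>
    MeasurableSpace.comap (allVars D X X₀ i) inferInstance) i hi)

/-- The event that the process has not stopped before step `n`. -/
abbrev running (A : Set (ℝ × ℝ)) (t : ℝ) (D X : ℕ → Ω → ℝ) (n : ℕ) : Set Ω :=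
  {ω | ∀ k < n, ¬ StopsAt A t (fun k => D k ω) (fun k => X k ω) k}

/-- The event that the process stops at step `n`. -/
abbrev stopped (A : Set (ℝ × ℝ)) (t : ℝ) (D X : ℕ → Ω → ℝ) (n : ℕ) : Set Ω :=
  {ω | FirstStopsAt A t (fun k => D k ω) (fun k => X k ω) n}

lemma running_zero {A : Set (ℝ × ℝ)} {t : ℝ} : running A t D X 0 = Set.univ := by
  ext ω
  simp [running]

end Family

section Data

variable {Ω : Type*} [MeasurableSpace Ω] {P : Measure Ω} {lam : ℝ}
  {ν ν₀ : Measure ℝ} {D X : ℕ → Ω → ℝ} {X₀ : Ω → ℝ}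

namespace IsBiddingData

lemma comap_le (hd : IsBiddingData P lam ν ν₀ D X X₀) (i : ℕ ⊕ ℕ ⊕ Unit) :
    MeasurableSpace.comap (allVars D X X₀ i) inferInstance ≤ ‹MeasurableSpace Ω› := by
  rcases i with n | n | _
  · exact (hd.measurable_duration n).comap_le
  · exact (hd.measurable_offer n).comap_le
  · exact hd.measurable_residual.comap_le

lemma sigmaOf_le (hd : IsBiddingData P lam ν ν₀ D X X₀) (I : Set (ℕ ⊕ ℕ ⊕ Unit)) :
    sigmaOf D X X₀ I ≤ ‹MeasurableSpace Ω› := iSup₂_le fun i _ => hd.comap_le i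

lemma indep_sigmaOf (hd : IsBiddingData P lam ν ν₀ D X X₀) {I J : Set (ℕ ⊕ ℕ ⊕ Unit)}
    (hIJ : Disjoint I J) : Indep (sigmaOf D X X₀ I) (sigmaOf D X X₀ J) P :=
  indep_iSup_of_disjoint hd.comap_le hd.indep hIJ

lemma ae_duration_nonneg (hd : IsBiddingData P lam ν ν₀ D X X₀) :
    ∀ᵐ ω ∂P, ∀ n, 0 ≤ D n ω := by
  rw [ae_all_iff]
  intro n
  have h : ∀ᵐ x ∂(P.map (D n)), 0 ≤ x := by
    rw [hd.law_duration, expMeasure, gammaMeasure,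
      ae_withDensity_iff (show Measurable (gammaPDF 1 lam) from
        (measurable_gammaPDFReal 1 lam).ennreal_ofReal)]
    refine ae_of_all _ fun x hx => ?_
    by_contra hneg
    exact hx (gammaPDF_of_neg (not_le.1 hneg))
  exact ae_of_ae_map (hd.measurable_duration n).aemeasurable h

variable [IsProbabilityMeasure P]

lemma map_duration_offer (hd : IsBiddingData P lam ν ν₀ D X X₀) (n : ℕ) :
    P.map (fun ω => (D n ω, X n ω)) = (expMeasure lam).prod ν := by
  have h : IndepFun (D n) (X n) P :=
    hd.indep.indepFun (i := Sum.inl n) (j := Sum.inr (Sum.inl n)) (by simp)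
  rw [h.map_prod_eq_prod_map_map (hd.measurable_duration n).aemeasurable
    (hd.measurable_offer n).aemeasurable, hd.law_duration, hd.law_offer]

/-- Averaging over the duration and the offer number `n`, given the earlier ones. -/
lemma setLIntegral_comp_step (hd : IsBiddingData P lam ν ν₀ D X X₀) {A : Set (ℝ × ℝ)}
    (hA : MeasurableSet A) (t : ℝ) (n : ℕ) {F : ℝ → ℝ × ℝ → ENNReal}
    (hF : Measurable (Function.uncurry F)) :
    ∫⁻ ω in {ω | ∀ k < n, ¬ StopsAt A t (fun k => D k ω) (fun k => X k ω) k},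
        F (remaining (fun k => D k ω) t n) (D n ω, X n ω) ∂P
      = ∫⁻ ω in {ω | ∀ k < n, ¬ StopsAt A t (fun k => D k ω) (fun k => X k ω) k},
        ∫⁻ z, F (remaining (fun k => D k ω) t n) z ∂((expMeasure lam).prod ν) ∂P := by
  let I : Set (ℕ ⊕ ℕ ⊕ Unit) := {i | ∃ k < n, i = Sum.inl k ∨ i = Sum.inr (Sum.inl k)}
  let J : Set (ℕ ⊕ ℕ ⊕ Unit) := {i | i = Sum.inl n ∨ i = Sum.inr (Sum.inl n)}
  have hIJ : Disjoint I J := by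
    rw [Set.disjoint_left]
    rintro i ⟨k, hk, rfl | rfl⟩ (h | h) <;> simp_all
  have hDI : ∀ k < n, Measurable[sigmaOf D X X₀ I] (D k) := fun k hk =>
    measurable_sigmaOf (i := Sum.inl k) ⟨k, hk, Or.inl rfl⟩
  have hXI : ∀ k < n, Measurable[sigmaOf D X X₀ I] (X k) := fun k hk =>
    measurable_sigmaOf (i := Sum.inr (Sum.inl k)) ⟨k, hk, Or.inr rfl⟩
  have hZJ : Measurable[sigmaOf D X X₀ J] fun ω => (D n ω, X n ω) :=
    (measurable_sigmaOf (i := Sum.inl n) (Or.inl rfl)).prodMk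
      (measurable_sigmaOf (i := Sum.inr (Sum.inl n)) (Or.inr rfl))
  rw [← hd.map_duration_offer n]
  exact setLIntegral_comp_of_indep (hd.sigmaOf_le I)
    ((hd.measurable_duration n).prodMk (hd.measurable_offer n))
    (indep_of_indep_of_le_right (hd.indep_sigmaOf hIJ) hZJ.comap_le)
    (measurable_remaining hDI) (measurableSet_forall_not_stopsAt hA hDI hXI) hF

end IsBiddingData

/-! ### The one-step operator and optional stopping -/

open Classical in
/-- The payoff one step ahead, if `r` is the time remaining at the next offer `x`: the payoff `pay`
upon stopping, and `v` if the process goes on. -/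
noncomputable def stepPayoff (A : Set (ℝ × ℝ)) (pay : ℝ → ℝ → ENNReal) (v : ℝ → ENNReal)
    (r x : ℝ) : ENNReal := if r = 0 ∨ (r, x) ∈ A then pay r x else v r

lemma measurable_stepPayoff {A : Set (ℝ × ℝ)} (hA : MeasurableSet A) {pay : ℝ → ℝ → ENNReal}
    (hpay : Measurable (Function.uncurry pay)) {v : ℝ → ENNReal} (hv : Measurable v) :
    Measurable (Function.uncurry (stepPayoff A pay v)) :=
  Measurable.ite ((measurable_fst (measurableSet_singleton 0)).union hA) hpay
    (hv.comp measurable_fst)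

/-- The expected payoff one step ahead when the time remaining is `s`. -/
noncomputable def stepValue (lam : ℝ) (ν : Measure ℝ) (A : Set (ℝ × ℝ)) (pay : ℝ → ℝ → ENNReal)
    (v : ℝ → ENNReal) (s : ℝ) : ENNReal :=
  ∫⁻ d, ∫⁻ x, stepPayoff A pay v (max (s - d) 0) x ∂ν ∂(expMeasure lam)

namespace IsBiddingData

variable [IsProbabilityMeasure P] {A : Set (ℝ × ℝ)} {t : ℝ} {pay : ℝ → ℝ → ENNReal}
  {v : ℝ → ENNReal}

lemma setLIntegral_stepValue [IsProbabilityMeasure ν] (hd : IsBiddingData P lam ν ν₀ D X X₀)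
    (hlam : 0 < lam) (hA : MeasurableSet A) (hpay : Measurable (Function.uncurry pay))
    (hv : Measurable v) (n : ℕ) :
    ∫⁻ ω in running A t D X n, stepValue lam ν A pay v (remaining (fun k => D k ω) t n) ∂P
      = ∫⁻ ω in stopped A t D X n, pay (remaining (fun k => D k ω) t (n + 1)) (X n ω) ∂P
        + ∫⁻ ω in running A t D X (n + 1), v (remaining (fun k => D k ω) t (n + 1)) ∂P := by
  have := isProbabilityMeasure_expMeasure hlam
  have hG := measurable_stepPayoff hA hpay hv
  have hF : Measurable (Function.uncurry fun (s : ℝ) (z : ℝ × ℝ) =>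
      stepPayoff A pay v (max (s - z.1) 0) z.2) :=
    hG.comp (((measurable_fst.sub (measurable_fst.comp measurable_snd)).max
      measurable_const).prodMk (measurable_snd.comp measurable_snd))
  have hstopSet : MeasurableSet {ω | StopsAt A t (fun k => D k ω) (fun k => X k ω) n} :=
    measurableSet_stopsAt hA (fun k _ => hd.measurable_duration k) (hd.measurable_offer n)
  have hsucc : running A t D X n \ {ω | StopsAt A t (fun k => D k ω) (fun k => X k ω) n}
      = running A t D X (n + 1) := by
    ext ω
    constructor
    · rintro ⟨h1, h2⟩ k hk
      rcases Nat.lt_succ_iff_lt_or_eq.1 hk with h | rfl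
      · exact h1 k h
      · exact h2
    · exact fun h => ⟨fun k hk => h k (hk.trans n.lt_succ_self), h n n.lt_succ_self⟩
  have hval : ∀ s, stepValue lam ν A pay v s
      = ∫⁻ z, stepPayoff A pay v (max (s - z.1) 0) z.2 ∂((expMeasure lam).prod ν) := fun s =>
    (lintegral_prod _ (hF.comp measurable_prodMk_left).aemeasurable).symm
  simp_rw [hval]
  rw [← hd.setLIntegral_comp_step hA t n hF, ← lintegral_inter_add_sdiff _ _ hstopSet, hsucc]
  have hrun : MeasurableSet (running A t D X (n + 1)) := measurableSet_forall_not_stopsAt hA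
    (fun k _ => hd.measurable_duration k) fun k _ => hd.measurable_offer k
  congr 1
  · refine setLIntegral_congr_fun (measurableSet_firstStopsAt hA hd.measurable_duration
      hd.measurable_offer n) fun ω hω => ?_
    exact if_pos hω.2
  · exact setLIntegral_congr_fun hrun fun ω hω => if_neg (hω n n.lt_succ_self)

/-- Each further step is reached only if the next offer arrives within the time `t`. -/
lemma measure_running_le [IsProbabilityMeasure ν] (hd : IsBiddingData P lam ν ν₀ D X X₀)
    (hlam : 0 < lam) (hA : MeasurableSet A) (ht : 0 ≤ t) (n : ℕ) :
    P (running A t D X n) ≤ (expMeasure lam (Set.Iio t)) ^ n := by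
  induction n with
  | zero => rw [running_zero, pow_zero]; exact prob_le_one
  | succ n ih =>
    have h := hd.setLIntegral_stepValue hlam hA (t := t) (pay := fun _ _ => 0) (v := 1)
      (by fun_prop) measurable_one n
    have hle : ∀ᵐ ω ∂P, stepValue lam ν A (fun _ _ => 0) 1 (remaining (fun k => D k ω) t n)
        ≤ expMeasure lam (Set.Iio t) := by
      filter_upwards [hd.ae_duration_nonneg] with ω hω
      set s := remaining (fun k => D k ω) t n
      have hs : s ≤ t := remaining_le ht hω n
      rw [stepValue, ← lintegral_indicator_one measurableSet_Iio]
      refine lintegral_mono fun e => ?_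
      by_cases he : e < t
      · rw [Set.indicator_of_mem (show e ∈ Set.Iio t from he)]
        refine (lintegral_mono (g := fun _ => 1) fun x => ?_).trans (by simp)
        rw [stepPayoff]
        split_ifs <;> simp
      · rw [not_lt] at he
        have : max (s - e) 0 = 0 := max_eq_right (by linarith)
        simp [stepPayoff, this]
    simp only [lintegral_zero, zero_add, Pi.one_apply, setLIntegral_one] at h
    rw [← h, pow_succ']
    calc _ ≤ ∫⁻ _ in running A t D X n, expMeasure lam (Set.Iio t) ∂P :=
          lintegral_mono_ae (ae_restrict_of_ae hle)
      _ = expMeasure lam (Set.Iio t) * P (running A t D X n) := setLIntegral_const _ _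
      _ ≤ _ := mul_le_mul_right ih _

lemma tendsto_measure_running [IsProbabilityMeasure ν] (hd : IsBiddingData P lam ν ν₀ D X X₀)
    (hlam : 0 < lam) (hA : MeasurableSet A) (ht : 0 ≤ t) :
    Tendsto (fun n => P (running A t D X n)) atTop (𝓝 0) := by
  have := isProbabilityMeasure_expMeasure hlam
  refine tendsto_of_tendsto_of_tendsto_of_le_of_le tendsto_const_nhds
    (ENNReal.tendsto_pow_atTop_nhds_zero_of_lt_one (r := expMeasure lam (Set.Iio t)) ?_)
    (fun _ => zero_le) (fun n => hd.measure_running_le hlam hA ht n)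
  rw [← Set.compl_Ici, prob_compl_eq_one_sub measurableSet_Ici, expMeasure_Ici hlam ht]
  exact ENNReal.sub_lt_self ENNReal.one_ne_top one_ne_zero
    (ENNReal.ofReal_pos.2 (Real.exp_pos _)).ne'

lemma ae_exists_firstStopsAt [IsProbabilityMeasure ν] (hd : IsBiddingData P lam ν ν₀ D X X₀)
    (hlam : 0 < lam) (hA : MeasurableSet A) (ht : 0 ≤ t) :
    ∀ᵐ ω ∂P, ∃ n, FirstStopsAt A t (fun k => D k ω) (fun k => X k ω) n := by
  have h0 : P {ω | ∀ n, ¬ StopsAt A t (fun k => D k ω) (fun k => X k ω) n} = 0 :=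
    le_antisymm (ge_of_tendsto' (hd.tendsto_measure_running hlam hA ht) fun n =>
      measure_mono fun ω hω k _ => hω k) zero_le
  refine measure_mono_null (fun ω hω => ?_) h0
  intro n hn
  exact hω (exists_firstStopsAt_of_exists ⟨n, hn⟩)

/-- The integral of a payoff that is determined at the first stopping step. -/
lemma lintegral_eq_tsum [IsProbabilityMeasure ν] (hd : IsBiddingData P lam ν ν₀ D X X₀)
    (hlam : 0 < lam) (hA : MeasurableSet A) (ht : 0 ≤ t) {f : Ω → ENNReal} {g : ℕ → Ω → ENNReal}
    (h : ∀ n ω, FirstStopsAt A t (fun k => D k ω) (fun k => X k ω) n → f ω = g n ω) :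
    ∫⁻ ω, f ω ∂P = ∑' n, ∫⁻ ω in stopped A t D X n, g n ω ∂P := by
  have hm : ∀ n, MeasurableSet (stopped A t D X n) := fun n =>
    measurableSet_firstStopsAt hA hd.measurable_duration hd.measurable_offer n
  have huniv : P.restrict (⋃ n, stopped A t D X n) = P := by
    refine Measure.restrict_eq_self_of_ae_mem ?_
    filter_upwards [hd.ae_exists_firstStopsAt hlam hA ht] with ω hω
    exact Set.mem_iUnion.2 hω
  rw [← huniv, lintegral_iUnion hm fun m n hmn => Set.disjoint_left.2 fun ω h1 h2 =>
    hmn (FirstStopsAt.unique h1 h2), huniv]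
  exact tsum_congr fun n => setLIntegral_congr_fun (hm n) fun ω hω => h n ω hω

/-- Optional stopping for a supermartingale. -/
lemma tsum_pay_le [IsProbabilityMeasure ν] (hd : IsBiddingData P lam ν ν₀ D X X₀)
    (hlam : 0 < lam) (hA : MeasurableSet A) (ht : 0 ≤ t) (hpay : Measurable (Function.uncurry pay))
    (hv : Measurable v) (hle : ∀ s, 0 ≤ s → stepValue lam ν A pay v s ≤ v s) :
    ∑' n, ∫⁻ ω in stopped A t D X n, pay (remaining (fun k => D k ω) t (n + 1)) (X n ω) ∂P
      ≤ v t := by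
  have key : ∀ n, ∑ k ∈ Finset.range n,
      ∫⁻ ω in stopped A t D X k, pay (remaining (fun k => D k ω) t (k + 1)) (X k ω) ∂P
        + ∫⁻ ω in running A t D X n, v (remaining (fun k => D k ω) t n) ∂P ≤ v t := fun n => by
    induction n with
    | zero =>
      rw [running_zero]
      simp [remaining]
    | succ n ih =>
      rw [Finset.sum_range_succ, add_assoc, ← hd.setLIntegral_stepValue hlam hA hpay hv]
      exact le_trans (add_le_add_right
        (lintegral_mono fun ω => hle _ (remaining_nonneg ht n)) _) ih
  rw [ENNReal.tsum_eq_iSup_nat]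
  exact iSup_le fun n => le_self_add.trans (key n)

/-- Optional stopping for a martingale that is bounded before the process stops. -/
lemma tsum_pay_eq [IsProbabilityMeasure ν] (hd : IsBiddingData P lam ν ν₀ D X X₀)
    (hlam : 0 < lam) (hA : MeasurableSet A) (ht : 0 ≤ t) (hpay : Measurable (Function.uncurry pay))
    (hv : Measurable v) (heq : ∀ s, 0 ≤ s → stepValue lam ν A pay v s = v s) {C : ENNReal}
    (hC : C ≠ ⊤) (hvC : ∀ s, 0 ≤ s → s ≤ t → v s ≤ C) :
    ∑' n, ∫⁻ ω in stopped A t D X n, pay (remaining (fun k => D k ω) t (n + 1)) (X n ω) ∂P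
      = v t := by
  refine le_antisymm (hd.tsum_pay_le hlam hA ht hpay hv fun s hs => (heq s hs).le) ?_
  have key : ∀ n, ∑ k ∈ Finset.range n,
      ∫⁻ ω in stopped A t D X k, pay (remaining (fun k => D k ω) t (k + 1)) (X k ω) ∂P
        + ∫⁻ ω in running A t D X n, v (remaining (fun k => D k ω) t n) ∂P = v t := fun n => by
    induction n with
    | zero =>
      rw [running_zero]
      simp [remaining]
    | succ n ih =>
      rw [Finset.sum_range_succ, add_assoc, ← hd.setLIntegral_stepValue hlam hA hpay hv, ← ih]
      congr 1
      exact lintegral_congr fun ω => heq _ (remaining_nonneg ht n)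
  have hbound : ∀ n, v t ≤ ∑' n, ∫⁻ ω in stopped A t D X n,
      pay (remaining (fun k => D k ω) t (n + 1)) (X n ω) ∂P + C * P (running A t D X n) :=
    fun n => by
      rw [← key n, ← setLIntegral_const]
      refine add_le_add (ENNReal.sum_le_tsum _) (lintegral_mono_ae (ae_restrict_of_ae ?_))
      filter_upwards [hd.ae_duration_nonneg] with ω hω
      exact hvC _ (remaining_nonneg ht n) (remaining_le ht hω n)
  refine ge_of_tendsto' (x := atTop) ?_ hbound
  have := ENNReal.Tendsto.const_mul (hd.tendsto_measure_running hlam hA ht (t := t))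
    (Or.inr hC)
  simpa using tendsto_const_nhds.add this

end IsBiddingData

end Data

/-! ### The one-step equations -/

/-- Conditioning on the first arrival: the equation for `v` with integrating factor
`exp (lam * r)` is a renewal equation for the exponential distribution. -/
lemma lintegral_expMeasure_eq_of_integral {lam : ℝ} (hlam : 0 < lam) {ψ : ℝ → ℝ}
    (hψ : ∀ r, 0 < r → 0 ≤ ψ r) {c v s : ℝ} (hc : 0 ≤ c) (hs : 0 ≤ s)
    (hint : IntervalIntegrable (fun r => lam * Real.exp (lam * r) * ψ r) volume 0 s)
    (hval : ∫ r in 0..s, lam * Real.exp (lam * r) * ψ r = Real.exp (lam * s) * v - c)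
    {Ψ : ℝ → ENNReal} (hΨm : Measurable Ψ) (hΨ0 : Ψ 0 = ENNReal.ofReal c)
    (hΨ : ∀ᵐ r, 0 < r → Ψ r = ENNReal.ofReal (ψ r)) :
    ∫⁻ d, Ψ (max (s - d) 0) ∂(expMeasure lam) = ENNReal.ofReal v := by
  have hΨc : Measurable fun d => Ψ (max (s - d) 0) := hΨm.comp (by fun_prop)
  -- No arrival within the time `s`.
  have h1 : ∫⁻ d in Set.Ici s, Ψ (max (s - d) 0) ∂(expMeasure lam)
      = ENNReal.ofReal (c * Real.exp (-(lam * s))) := by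
    rw [setLIntegral_congr_fun (g := fun _ => ENNReal.ofReal c) measurableSet_Ici fun d hd => ?_,
      setLIntegral_const, expMeasure_Ici hlam hs, ENNReal.ofReal_mul hc]
    have : s ≤ d := hd
    rw [max_eq_right (by linarith), hΨ0]
  -- An arrival with the time `r = s - d` remaining; the density vanishes for `r > s`.
  have h2 : ∫⁻ d in (Set.Ici s)ᶜ, Ψ (max (s - d) 0) ∂(expMeasure lam)
      = ENNReal.ofReal (v - c * Real.exp (-(lam * s))) := by
    have hpdf : Measurable (exponentialPDF lam) :=
      (measurable_exponentialPDFReal lam).ennreal_ofReal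
    have hmeas : expMeasure lam = volume.withDensity (exponentialPDF lam) := rfl
    have hsub : ∀ d, ((Set.Ici s)ᶜ).indicator
        (fun d => (exponentialPDF lam * fun d => Ψ (max (s - d) 0)) d) d
        = (Set.Ioc 0 s).indicator
          (fun r => ENNReal.ofReal (lam * Real.exp (-(lam * (s - r)))) * Ψ r) (s - d) := fun d => by
      by_cases hd : s ≤ d
      · rw [Set.indicator_of_notMem (by simpa using hd),
          Set.indicator_of_notMem (by simp [hd])]
      · rw [Set.indicator_of_mem (by simpa using hd)]
        rw [not_le] at hd
        rw [Pi.mul_apply, max_eq_left (by linarith)]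
        rcases lt_or_ge d 0 with h0 | h0
        · rw [exponentialPDF_of_neg h0, zero_mul, Set.indicator_of_notMem]
          simp [h0]
        · rw [exponentialPDF_of_nonneg h0, Set.indicator_of_mem, sub_sub_cancel]
          exact ⟨by linarith, by linarith⟩
    rw [hmeas, setLIntegral_withDensity_eq_setLIntegral_mul _ hpdf hΨc measurableSet_Ici.compl,
      ← lintegral_indicator measurableSet_Ici.compl, lintegral_congr hsub,
      lintegral_sub_left_eq_self (μ := volume) (fun r => (Set.Ioc 0 s).indicator
        (fun r => ENNReal.ofReal (lam * Real.exp (-(lam * (s - r)))) * Ψ r) r) s,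
      lintegral_indicator measurableSet_Ioc]
    have hae : ∀ᵐ r ∂(volume.restrict (Set.Ioc 0 s)),
        ENNReal.ofReal (lam * Real.exp (-(lam * (s - r)))) * Ψ r
          = ENNReal.ofReal
            (Real.exp (-(lam * s)) * (lam * Real.exp (lam * r) * ψ r)) := by
      filter_upwards [ae_restrict_of_ae hΨ, ae_restrict_mem measurableSet_Ioc] with r hr hmem
      rw [hr hmem.1, ← ENNReal.ofReal_mul (by positivity)]
      congr 1
      rw [show -(lam * (s - r)) = -(lam * s) + lam * r by ring, Real.exp_add]
      ring
    rw [lintegral_congr_ae hae, ← ofReal_integral_eq_lintegral_ofReal]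
    · rw [integral_const_mul, ← intervalIntegral.integral_of_le hs, hval, mul_sub, ← mul_assoc,
        ← Real.exp_add, neg_add_cancel, Real.exp_zero, one_mul, mul_comm c]
    · exact (((intervalIntegrable_iff_integrableOn_Ioc_of_le hs).1 hint).const_mul _)
    · filter_upwards [ae_restrict_mem measurableSet_Ioc] with r hmem
      have := hψ r hmem.1
      exact mul_nonneg (Real.exp_pos _).le (by positivity)
  have hnn : 0 ≤ v - c * Real.exp (-(lam * s)) := by
    have h0 : 0 ≤ Real.exp (lam * s) * v - c := by
      rw [← hval]
      refine intervalIntegral.integral_nonneg_of_ae_restrict hs ?_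
      rw [← Measure.restrict_congr_set Ioc_ae_eq_Icc]
      filter_upwards [ae_restrict_mem measurableSet_Ioc] with r hmem
      have := hψ r hmem.1
      simp only [Pi.zero_apply]
      positivity
    have := mul_nonneg (Real.exp_pos (-(lam * s))).le h0
    rwa [mul_sub, ← mul_assoc, ← Real.exp_add, neg_add_cancel, Real.exp_zero, one_mul,
      mul_comm _ c] at this
  rw [← lintegral_add_compl _ (measurableSet_Ici (a := s)), h1, h2,
    ← ENNReal.ofReal_add (by positivity) hnn, add_sub_cancel]

/-- The policy that accepts an offer if it is at least the value `y` of waiting. -/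
def acceptSet (y : ℝ → ℝ) : Set (ℝ × ℝ) := {p | y p.1 ≤ p.2}

lemma measurableSet_acceptSet {y : ℝ → ℝ} (hy : Measurable y) : MeasurableSet (acceptSet y) :=
  measurableSet_le (hy.comp measurable_fst) measurable_snd

/-- The positive part of the sale price, with the residual price replaced by its mean `m₀`. -/
noncomputable def pricePay (m₀ r x : ℝ) : ENNReal :=
  if r = 0 then ENNReal.ofReal m₀ else ENNReal.ofReal x

lemma measurable_pricePay (m₀ : ℝ) : Measurable (Function.uncurry (pricePay m₀)) :=
  Measurable.ite (measurable_fst (measurableSet_singleton 0)) measurable_const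
    measurable_snd.ennreal_ofReal

/-- The indicator of stopping with a time remaining below `r₀`. -/
noncomputable def latePay (r₀ r _x : ℝ) : ENNReal := if r < r₀ then 1 else 0

lemma measurable_latePay (r₀ : ℝ) : Measurable (Function.uncurry (latePay r₀)) :=
  Measurable.ite (measurable_fst measurableSet_Iio) measurable_const measurable_const

/-- The probability of stopping with a time remaining below `r₀`, as a function of the time `r`
to the deadline. -/
noncomputable def lateValue (ν : Measure ℝ) (lam : ℝ) (y : ℝ → ℝ) (r₀ r : ℝ) : ENNReal :=
  if r < r₀ then 1 else ENNReal.ofReal (speed ν lam y r / speed ν lam y r₀)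

section OneStep

variable {ν : Measure ℝ} [IsProbabilityMeasure ν] {lam m₀ : ℝ} {y : ℝ → ℝ}

lemma lintegral_max (hν : Integrable (fun x : ℝ => max x 0) ν) {m : ℝ} (hm : 0 ≤ m) :
    ∫⁻ x, ENNReal.ofReal (max x m) ∂ν = ENNReal.ofReal (m + excess ν m) := by
  have h : ∀ x, max x m = m + max (x - m) 0 := fun x => by
    rw [← max_add_add_left, add_sub_cancel, add_zero]
  simp_rw [h]
  rw [← ofReal_integral_eq_lintegral_ofReal (f := fun x => m + max (x - m) 0)
    ((integrable_const m).add (integrable_excess hν m))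
    (ae_of_all _ fun x => add_nonneg hm (le_max_right _ _)),
    integral_add (integrable_const m) (integrable_excess hν m)]
  simp [excess]

/-- The right-hand side of the optimality equation of dynamic programming. -/
lemma lintegral_expMeasure_max (hν : Integrable (fun x : ℝ => max x 0) ν) (hlam : 0 < lam)
    (hm₀ : 0 ≤ m₀) (hy : IsValueCurve ν lam m₀ y) {s : ℝ} (hs : 0 ≤ s) :
    ∫⁻ d, (if max (s - d) 0 = 0 then ENNReal.ofReal m₀ else
      ∫⁻ x, ENNReal.ofReal (max x (y (max (s - d) 0))) ∂ν) ∂(expMeasure lam)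
      = ENNReal.ofReal (y s) := by
  have hy0 : ∀ r, 0 ≤ r → 0 ≤ y r := fun r hr => hm₀.trans (hy.zero ▸ hy.monotone hr)
  have hcont : Continuous fun r => y r + excess ν (y r) :=
    hy.continuous.add ((lipschitzWith_excess hν).continuous.comp hy.continuous)
  refine lintegral_expMeasure_eq_of_integral hlam (ψ := fun r => y r + excess ν (y r))
    (Ψ := fun r => if r = 0 then ENNReal.ofReal m₀ else ∫⁻ x, ENNReal.ofReal (max x (y r)) ∂ν)
    (fun r hr => add_nonneg (hy0 r hr.le) (excess_nonneg _)) hm₀ hs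
    (Continuous.intervalIntegrable (by fun_prop) _ _) (integral_exp_mul_valueCurve hν hy hs)
    ?_ (if_pos rfl) (ae_of_all _ fun r hr => ?_)
  · refine Measurable.ite (measurableSet_singleton 0) measurable_const ?_
    have : Measurable fun p : ℝ × ℝ => ENNReal.ofReal (max p.2 (y p.1)) :=
      (measurable_snd.max (hy.continuous.measurable.comp measurable_fst)).ennreal_ofReal
    exact this.lintegral_prod_right'
  · rw [if_neg hr.ne']
    exact lintegral_max hν (hy0 r hr.le)

lemma stepValue_pricePay_le (hν : Integrable (fun x : ℝ => max x 0) ν) (hlam : 0 < lam)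
    (hm₀ : 0 ≤ m₀) (hy : IsValueCurve ν lam m₀ y) (A : Set (ℝ × ℝ)) {s : ℝ} (hs : 0 ≤ s) :
    stepValue lam ν A (pricePay m₀) (fun r => ENNReal.ofReal (y r)) s ≤ ENNReal.ofReal (y s) := by
  rw [← lintegral_expMeasure_max hν hlam hm₀ hy hs, stepValue]
  refine lintegral_mono fun d => ?_
  beta_reduce
  split_ifs with h
  · simp [stepPayoff, pricePay, h]
  · refine lintegral_mono fun x => ?_
    simp only [stepPayoff, pricePay, h, false_or, if_false]
    split_ifs
    · exact ENNReal.ofReal_le_ofReal (le_max_left _ _)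
    · exact ENNReal.ofReal_le_ofReal (le_max_right _ _)

lemma stepValue_pricePay_acceptSet (hν : Integrable (fun x : ℝ => max x 0) ν) (hlam : 0 < lam)
    (hm₀ : 0 ≤ m₀) (hy : IsValueCurve ν lam m₀ y) {s : ℝ} (hs : 0 ≤ s) :
    stepValue lam ν (acceptSet y) (pricePay m₀) (fun r => ENNReal.ofReal (y r)) s
      = ENNReal.ofReal (y s) := by
  rw [← lintegral_expMeasure_max hν hlam hm₀ hy hs, stepValue]
  refine lintegral_congr fun d => ?_
  split_ifs with h
  · simp [stepPayoff, pricePay, h]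
  · refine lintegral_congr fun x => ?_
    simp only [stepPayoff, pricePay, h, false_or, if_false, acceptSet, Set.mem_ofPred]
    split_ifs with hx
    · rw [max_eq_left hx]
    · rw [max_eq_right (not_le.1 hx).le]

lemma measurable_lateValue (hν : Integrable (fun x : ℝ => max x 0) ν)
    (hy : IsValueCurve ν lam m₀ y) (r₀ : ℝ) : Measurable (lateValue ν lam y r₀) :=
  Measurable.ite measurableSet_Iio measurable_const
    ((continuous_speed hν hy).measurable.div_const _).ennreal_ofReal

lemma lateValue_le_one (hν : Integrable (fun x : ℝ => max x 0) ν) (hlam : 0 < lam)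
    (hm₀ : (m₀ : EReal) < supSupport ν) (hy : IsValueCurve ν lam m₀ y) {r₀ : ℝ} (hr₀ : 0 < r₀)
    (r : ℝ) : lateValue ν lam y r₀ r ≤ 1 := by
  rw [lateValue]
  split_ifs with h
  · exact le_rfl
  · rw [ENNReal.ofReal_le_one, div_le_one (speed_pos hν hlam hm₀ hy hr₀.le)]
    exact speed_antitone hν hlam hy (not_lt.1 h)

lemma integral_exp_const_mul (lam s : ℝ) :
    ∫ r in 0..s, lam * Real.exp (lam * r) = Real.exp (lam * s) - 1 := by
  rw [intervalIntegral.integral_eq_sub_of_hasDerivAt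
    (fun r _ => hasDerivAt_exp_const_mul lam r)
    (Continuous.intervalIntegrable (by fun_prop) _ _)]
  simp

/-- Above `r₀` the process goes on at an offer exactly if the offer is below the value curve, hence
the probability of a late stop satisfies the same linear equation as the speed. -/
lemma stepValue_latePay (hν : Integrable (fun x : ℝ => max x 0) ν) (hlam : 0 < lam)
    (hm₀ : (m₀ : EReal) < supSupport ν) (hy : IsValueCurve ν lam m₀ y) {r₀ : ℝ} (hr₀ : 0 < r₀)
    {s : ℝ} (hs : 0 ≤ s) :
    stepValue lam ν (acceptSet y) (latePay r₀) (lateValue ν lam y r₀) s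
      = lateValue ν lam y r₀ s := by
  have hq0 := speed_pos hν hlam hm₀ hy hr₀.le
  have hqnn : ∀ r, 0 ≤ speed ν lam y r := fun r => mul_nonneg hlam.le (excess_nonneg _)
  set ψ : ℝ → ℝ := fun r =>
    if r < r₀ then 1 else ν.real (Set.Iic (y r)) * speed ν lam y r / speed ν lam y r₀ with hψ
  have hlow : ∀ s, s ≤ r₀ →
      Set.EqOn (fun r => lam * Real.exp (lam * r) * ψ r) (fun r => lam * Real.exp (lam * r))
        (Set.Ioo 0 s) := fun s hs r hr => by
    simp only [hψ]
    rw [if_pos (hr.2.trans_le hs), mul_one]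
  have hlowint : ∀ s, 0 ≤ s → s ≤ r₀ →
      IntervalIntegrable (fun r => lam * Real.exp (lam * r) * ψ r) volume 0 s ∧
      ∫ r in 0..s, lam * Real.exp (lam * r) * ψ r = Real.exp (lam * s) - 1 := fun s hs hsr => by
    constructor
    · refine (Continuous.intervalIntegrable (u := fun r => lam * Real.exp (lam * r))
        (by fun_prop) 0 s).congr_ae ?_
      rw [Set.uIoc_of_le hs, ← Measure.restrict_congr_set Ioo_ae_eq_Ioc]
      filter_upwards [ae_restrict_mem measurableSet_Ioo] with r hr
      exact (hlow s hsr hr).symm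
    · rw [← integral_exp_const_mul, intervalIntegral.integral_of_le hs,
        intervalIntegral.integral_of_le hs, integral_Ioc_eq_integral_Ioo,
        integral_Ioc_eq_integral_Ioo]
      exact setIntegral_congr_fun measurableSet_Ioo (hlow s hsr)
  have hhigh : r₀ ≤ s →
      IntervalIntegrable (fun r => lam * Real.exp (lam * r) * ψ r) volume r₀ s ∧
      ∫ r in r₀..s, lam * Real.exp (lam * r) * ψ r
        = Real.exp (lam * s) * (speed ν lam y s / speed ν lam y r₀) - Real.exp (lam * r₀) :=
    fun hsr => by
      obtain ⟨hi, he⟩ := integral_exp_mul_speed hν hy hr₀.le hsr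
      have hcongr : Set.EqOn
          (fun r => lam * Real.exp (lam * r) * (ν.real (Set.Iic (y r)) * speed ν lam y r)
            / speed ν lam y r₀)
          (fun r => lam * Real.exp (lam * r) * ψ r) (Set.uIcc r₀ s) := fun r hr => by
        rw [Set.uIcc_of_le hsr] at hr
        simp only [hψ]
        rw [if_neg (not_lt.2 hr.1), mul_div_assoc]
      constructor
      · exact (hi.div_const _).congr fun r hr => hcongr (Set.uIoc_subset_uIcc hr)
      · rw [← intervalIntegral.integral_congr hcongr, intervalIntegral.integral_div, he]
        field_simp
  have hψint : IntervalIntegrable (fun r => lam * Real.exp (lam * r) * ψ r) volume 0 s := by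
    rcases le_total s r₀ with h | h
    · exact (hlowint s hs h).1
    · exact (hlowint r₀ hr₀.le le_rfl).1.trans (hhigh h).1
  have hlate : lateValue ν lam y r₀ s = ENNReal.ofReal
      (if s < r₀ then 1 else speed ν lam y s / speed ν lam y r₀) := by
    rw [lateValue]; split_ifs <;> simp
  have hG : Measurable (Function.uncurry
      (stepPayoff (acceptSet y) (latePay r₀) (lateValue ν lam y r₀))) :=
    measurable_stepPayoff (measurableSet_acceptSet hy.continuous.measurable)
      (measurable_latePay r₀) (measurable_lateValue hν hy r₀)
  rw [hlate, stepValue]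
  refine lintegral_expMeasure_eq_of_integral hlam (ψ := ψ) (c := 1) (Ψ := fun r =>
    ∫⁻ x, stepPayoff (acceptSet y) (latePay r₀) (lateValue ν lam y r₀) r x ∂ν) (fun r _ => ?_)
    zero_le_one hs hψint ?_ hG.lintegral_prod_right' ?_ ?_
  · simp only [hψ]
    split_ifs
    · exact zero_le_one
    · exact div_nonneg (mul_nonneg measureReal_nonneg (hqnn r)) hq0.le
  · split_ifs with h
    · rw [(hlowint s hs h.le).2, mul_one]
    · rw [← intervalIntegral.integral_add_adjacent_intervals
        (hlowint r₀ hr₀.le le_rfl).1 (hhigh (not_lt.1 h)).1, (hlowint r₀ hr₀.le le_rfl).2,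
        (hhigh (not_lt.1 h)).2]
      ring
  · simp [stepPayoff, latePay, hr₀]
  · filter_upwards [ae_Iio_eq_Iic hν hlam hm₀ hy] with r hr hr0
    rcases lt_or_ge r r₀ with h | h
    · simp [stepPayoff, latePay, lateValue, hψ, h]
    · have hstep : ∀ x, stepPayoff (acceptSet y) (latePay r₀) (lateValue ν lam y r₀) r x
          = (Set.Iio (y r)).indicator
            (fun _ => ENNReal.ofReal (speed ν lam y r / speed ν lam y r₀)) x := fun x => by
        by_cases hx : y r ≤ x
        · rw [Set.indicator_of_notMem (by simpa using hx), stepPayoff,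
            if_pos (Or.inr (show (r, x) ∈ acceptSet y from hx)), latePay, if_neg (not_lt.2 h)]
        · rw [Set.indicator_of_mem (by simpa using hx), stepPayoff,
            if_neg (by rintro (h0 | h0); exacts [hr0.ne' h0, hx h0]), lateValue,
            if_neg (not_lt.2 h)]
      simp_rw [hstep]
      rw [lintegral_indicator_const measurableSet_Iio, hr hr0.le, ← ofReal_measureReal,
        ← ENNReal.ofReal_mul (div_nonneg (hqnn r) hq0.le)]
      simp only [hψ]
      rw [if_neg (not_lt.2 h)]
      congr 1
      ring

end OneStep

/-! ### The optimal value and the law of the time to sale -/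

namespace IsBiddingData

variable {Ω : Type*} [MeasurableSpace Ω] {P : Measure Ω} [IsProbabilityMeasure P] {lam : ℝ}
  {ν ν₀ : Measure ℝ} {D X : ℕ → Ω → ℝ}
  {X₀ : Ω → ℝ} {y : ℝ → ℝ} {A : Set (ℝ × ℝ)} {t : ℝ}

/-- The residual price is independent of the event that it is paid, and can be replaced by its
mean. -/
lemma saleRV_sub_salePrice_mean (hd : IsBiddingData P lam ν ν₀ D X X₀)
    (hν₀ : Integrable (fun x : ℝ => x) ν₀) (hA : MeasurableSet A) (t : ℝ) :
    ∃ W : Ω → ℝ, Integrable W P ∧ ∫ ω, W ω ∂P = 0 ∧ ∀ ω, saleRV D X X₀ A t ω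
      = salePrice A t (fun n => D n ω) (fun n => X n ω) (∫ x, x ∂ν₀) + W ω := by
  let I : Set (ℕ ⊕ ℕ ⊕ Unit) := {i | i ≠ Sum.inr (Sum.inr ())}
  let J : Ω → ℝ := fun ω => salePrice A t (fun n => D n ω) (fun n => X n ω) 1
    - salePrice A t (fun n => D n ω) (fun n => X n ω) 0
  have hDI : ∀ k, Measurable[sigmaOf D X X₀ I] (D k) := fun k =>
    measurable_sigmaOf (i := Sum.inl k) (by simp [I])
  have hXI : ∀ k, Measurable[sigmaOf D X X₀ I] (X k) := fun k =>
    measurable_sigmaOf (i := Sum.inr (Sum.inl k)) (by simp [I])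
  have hJI : Measurable[sigmaOf D X X₀ I] J :=
    (measurable_salePrice hA hDI hXI measurable_const).sub
      (measurable_salePrice hA hDI hXI measurable_const)
  have hJ : Measurable J := hJI.mono (hd.sigmaOf_le I) le_rfl
  have hX₀ : Measurable[sigmaOf D X X₀ Iᶜ] X₀ :=
    measurable_sigmaOf (i := Sum.inr (Sum.inr ())) (by simp [I])
  have hind : IndepFun J X₀ P :=
    indep_of_indep_of_le_right (indep_of_indep_of_le_left
      (hd.indep_sigmaOf disjoint_compl_right) hJI.comap_le) hX₀.comap_le
  have hX₀int : Integrable X₀ P := by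
    have h := hν₀
    rw [← hd.law_residual, integrable_map_measure (by fun_prop)
      hd.measurable_residual.aemeasurable] at h
    exact h
  have hmean : ∫ ω, X₀ ω ∂P = ∫ x, x ∂ν₀ := by
    rw [← hd.law_residual, integral_map hd.measurable_residual.aemeasurable (by fun_prop)]
  have hdiff : Integrable (fun ω => X₀ ω - ∫ x, x ∂ν₀) P := hX₀int.sub (integrable_const _)
  refine ⟨fun ω => J ω * (X₀ ω - ∫ x, x ∂ν₀), ?_, ?_, fun ω => salePrice_eq_add _ _ _ _ _ _⟩
  · exact hdiff.bdd_mul hJ.aestronglyMeasurable (c := 1)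
      (ae_of_all _ fun ω => abs_salePrice_one_sub_zero_le _ _ _ _)
  · have hind' : IndepFun J (fun ω => X₀ ω - ∫ x, x ∂ν₀) P :=
      hind.comp measurable_id (measurable_id.sub_const _)
    rw [hind'.integral_fun_mul_eq_mul_integral hJ.aestronglyMeasurable
      hdiff.aestronglyMeasurable, integral_sub hX₀int (integrable_const _), hmean]
    simp

variable [IsProbabilityMeasure ν]

lemma lintegral_salePrice_mean (hd : IsBiddingData P lam ν ν₀ D X X₀) (hlam : 0 < lam)
    (hA : MeasurableSet A) (ht : 0 ≤ t) (m₀ : ℝ) :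
    ∫⁻ ω, ENNReal.ofReal (salePrice A t (fun n => D n ω) (fun n => X n ω) m₀) ∂P
      = ∑' n, ∫⁻ ω in stopped A t D X n,
        pricePay m₀ (remaining (fun k => D k ω) t (n + 1)) (X n ω) ∂P := by
  refine hd.lintegral_eq_tsum hlam hA ht fun n ω h => ?_
  rw [h.salePrice_eq, pricePay]
  split_ifs <;> rfl

/-- The value curve is the supremum over all policies, attained by the policy that accepts exactly
the offers that are at least the value of waiting. -/
lemma optimalValue_eq (hd : IsBiddingData P lam ν ν₀ D X X₀) (hlam : 0 < lam)
    (hν : Integrable (fun x : ℝ => max x 0) ν) (hν₀ : Integrable (fun x : ℝ => x) ν₀)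
    (hμ₀ : 0 ≤ ∫ x, x ∂ν₀) (hy : IsValueCurve ν lam (∫ x, x ∂ν₀) y) (ht : 0 ≤ t) :
    optimalValue P D X X₀ t = y t := by
  set m₀ := ∫ x, x ∂ν₀
  have hym : Measurable fun r => ENNReal.ofReal (y r) := hy.continuous.measurable.ennreal_ofReal
  have hy0 : ∀ r, 0 ≤ r → 0 ≤ y r := fun r hr => hμ₀.trans (hy.zero ▸ hy.monotone hr)
  have hprice : ∀ A : Set (ℝ × ℝ), MeasurableSet A → Measurable fun ω =>
      salePrice A t (fun n => D n ω) (fun n => X n ω) m₀ := fun A hA =>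
    measurable_salePrice hA hd.measurable_duration hd.measurable_offer measurable_const
  refine IsGreatest.csSup_eq ⟨?_, ?_⟩
  · have hA := measurableSet_acceptSet hy.continuous.measurable
    obtain ⟨W, hW, hW0, hWeq⟩ := hd.saleRV_sub_salePrice_mean hν₀ hA t
    have hval : ∫⁻ ω, ENNReal.ofReal
        (salePrice (acceptSet y) t (fun n => D n ω) (fun n => X n ω) m₀) ∂P
        = ENNReal.ofReal (y t) := by
      rw [hd.lintegral_salePrice_mean hlam hA ht]
      exact hd.tsum_pay_eq hlam hA ht (measurable_pricePay m₀) hym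
        (fun s hs => stepValue_pricePay_acceptSet hν hlam hμ₀ hy hs) ENNReal.ofReal_ne_top
        fun s _ hst => ENNReal.ofReal_le_ofReal (hy.monotone hst)
    have hnn : ∀ᵐ ω ∂P, 0 ≤ salePrice (acceptSet y) t (fun n => D n ω) (fun n => X n ω) m₀ := by
      filter_upwards [hd.ae_exists_firstStopsAt hlam hA ht] with ω ⟨n, hn⟩
      rw [hn.salePrice_eq]
      split_ifs with h
      · exact hμ₀
      · exact (hy0 _ (remaining_nonneg ht _)).trans (hn.2.resolve_left h)
    have hint : Integrable (fun ω =>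
        salePrice (acceptSet y) t (fun n => D n ω) (fun n => X n ω) m₀) P := by
      refine ⟨(hprice _ hA).aestronglyMeasurable, ?_⟩
      rw [hasFiniteIntegral_iff_ofReal hnn, hval]
      exact ENNReal.ofReal_lt_top
    refine ⟨acceptSet y, hA, ?_, ?_⟩
    · exact (hint.add hW).congr (ae_of_all _ fun ω => (hWeq ω).symm)
    · rw [integral_congr_ae (ae_of_all _ hWeq), integral_add hint hW, hW0, add_zero,
        integral_eq_lintegral_of_nonneg_ae hnn hint.aestronglyMeasurable, hval,
        ENNReal.toReal_ofReal (hy0 t ht)]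
  · rintro _ ⟨A, hA, hint, rfl⟩
    obtain ⟨W, hW, hW0, hWeq⟩ := hd.saleRV_sub_salePrice_mean hν₀ hA t
    have hint' : Integrable (fun ω =>
        salePrice A t (fun n => D n ω) (fun n => X n ω) m₀) P :=
      (hint.sub hW).congr (ae_of_all _ fun ω => by
        rw [Pi.sub_apply, hWeq ω, add_sub_cancel_right])
    rw [integral_congr_ae (ae_of_all _ hWeq), integral_add hint' hW, hW0, add_zero,
      integral_eq_lintegral_pos_part_sub_lintegral_neg_part hint']
    refine (sub_le_self _ ENNReal.toReal_nonneg).trans ?_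
    refine ENNReal.toReal_le_of_le_ofReal (hy0 t ht) ?_
    rw [hd.lintegral_salePrice_mean hlam hA ht]
    exact hd.tsum_pay_le hlam hA ht (measurable_pricePay m₀) hym
      fun s hs => stepValue_pricePay_le hν hlam hμ₀ hy A hs

lemma T_eq (hd : IsBiddingData P lam ν ν₀ D X X₀) (hlam : 0 < lam)
    (hν : Integrable (fun x : ℝ => max x 0) ν) (hν₀ : Integrable (fun x : ℝ => x) ν₀)
    (hμ₀ : 0 ≤ ∫ x, x ∂ν₀) (hy : IsValueCurve ν lam (∫ x, x ∂ν₀) y) (t : ℝ) (ω : Ω) :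
    T P D X X₀ t ω = timeToSale (acceptSet y) t (fun n => D n ω) (fun n => X n ω) := by
  refine timeToSale_congr (fun r x hr => ?_) _ _ _
  rw [optimalPolicy, acceptSet, Set.mem_ofPred, Set.mem_ofPred,
    hd.optimalValue_eq hlam hν hν₀ hμ₀ hy hr]

lemma measurable_T (hd : IsBiddingData P lam ν ν₀ D X X₀) (hlam : 0 < lam)
    (hν : Integrable (fun x : ℝ => max x 0) ν) (hν₀ : Integrable (fun x : ℝ => x) ν₀)
    (hμ₀ : 0 ≤ ∫ x, x ∂ν₀) (hy : IsValueCurve ν lam (∫ x, x ∂ν₀) y) (t : ℝ) :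
    Measurable (T P D X X₀ t) := by
  rw [funext (hd.T_eq hlam hν hν₀ hμ₀ hy t)]
  exact measurable_timeToSale (measurableSet_acceptSet hy.continuous.measurable)
    hd.measurable_duration hd.measurable_offer

lemma ae_T_mem_Icc (hd : IsBiddingData P lam ν ν₀ D X X₀) (hlam : 0 < lam)
    (hν : Integrable (fun x : ℝ => max x 0) ν) (hν₀ : Integrable (fun x : ℝ => x) ν₀)
    (hμ₀ : 0 ≤ ∫ x, x ∂ν₀) (hy : IsValueCurve ν lam (∫ x, x ∂ν₀) y) (ht : 0 ≤ t) :
    ∀ᵐ ω ∂P, T P D X X₀ t ω ∈ Set.Icc 0 t := by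
  have hA := measurableSet_acceptSet hy.continuous.measurable
  filter_upwards [hd.ae_exists_firstStopsAt hlam hA ht, hd.ae_duration_nonneg] with ω ⟨n, hn⟩ hω
  rw [hd.T_eq hlam hν hν₀ hμ₀ hy, hn.timeToSale_eq]
  exact ⟨sub_nonneg.2 (remaining_le ht hω _), sub_le_self _ (remaining_nonneg ht _)⟩

/-- The tail of the time to sale is a ratio of values of `μ'`. -/
lemma measure_lt_T (hd : IsBiddingData P lam ν ν₀ D X X₀) (hlam : 0 < lam)
    (hν : Integrable (fun x : ℝ => max x 0) ν) (hν₀ : Integrable (fun x : ℝ => x) ν₀)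
    (hμ₀ : 0 ≤ ∫ x, x ∂ν₀) (hM : ((∫ x, x ∂ν₀ : ℝ) : EReal) < supSupport ν)
    (hy : IsValueCurve ν lam (∫ x, x ∂ν₀) y) {u : ℝ} (hu : 0 ≤ u) (hut : u < t) :
    P.real {ω | u < T P D X X₀ t ω} = speed ν lam y t / speed ν lam y (t - u) := by
  have hA := measurableSet_acceptSet hy.continuous.measurable
  have ht : 0 ≤ t := hu.trans hut.le
  have hr₀ : 0 < t - u := sub_pos.2 hut
  have hset : MeasurableSet {ω | u < T P D X X₀ t ω} :=
    measurableSet_lt measurable_const (hd.measurable_T hlam hν hν₀ hμ₀ hy t)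
  have h := hd.lintegral_eq_tsum hlam hA ht
    (f := {ω | u < T P D X X₀ t ω}.indicator 1)
    (g := fun n ω => latePay (t - u) (remaining (fun k => D k ω) t (n + 1)) (X n ω))
    fun n ω hn => by
      have hiff : ω ∈ {ω | u < T P D X X₀ t ω} ↔
          remaining (fun k => D k ω) t (n + 1) < t - u := by
        rw [Set.mem_ofPred, hd.T_eq hlam hν hν₀ hμ₀ hy, hn.timeToSale_eq, lt_sub_comm]
      rw [latePay, Set.indicator_apply]
      simp only [hiff, Pi.one_apply]
  rw [lintegral_indicator_one hset, hd.tsum_pay_eq hlam hA ht (measurable_latePay _)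
    (measurable_lateValue hν hy _) (fun s hs => stepValue_latePay hν hlam hM hy hr₀ hs)
    ENNReal.one_ne_top (fun s _ _ => lateValue_le_one hν hlam hM hy hr₀ s), lateValue,
    if_neg (by linarith)] at h
  rw [measureReal_def, h, ENNReal.toReal_ofReal]
  exact div_nonneg (speed_pos hν hlam hM hy ht).le (speed_pos hν hlam hM hy hr₀.le).le

end IsBiddingData

/-! ### Moments from tails -/

/-- The layer cake formula for a random variable with values in `[0, 1]`. -/
lemma integral_intervalIntegral_eq {Ω : Type*} [MeasurableSpace Ω] {P : Measure Ω}
    [IsProbabilityMeasure P] {f : Ω → ℝ} (hf : Measurable f)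
    (hf01 : ∀ᵐ ω ∂P, f ω ∈ Set.Icc (0 : ℝ) 1) {g : ℝ → ℝ} (hg : Continuous g)
    (hg0 : ∀ s, 0 < s → 0 ≤ g s) :
    ∫ ω, (∫ s in 0..f ω, g s) ∂P = ∫ s in 0..1, P.real {ω | s < f ω} * g s := by
  have htail : Measurable fun s => P.real {ω | s < f ω} :=
    (show Antitone fun s => P.real {ω | s < f ω} from fun a b hab =>
      measureReal_mono fun ω hω => hab.trans_lt hω).measurable
  have hprim : Continuous fun b => ∫ s in 0..b, g s :=
    intervalIntegral.continuous_primitive (fun a b => hg.intervalIntegrable a b) 0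
  have hgae : ∀ᵐ s ∂(volume.restrict (Set.Ioi (0 : ℝ))), 0 ≤ g s := by
    filter_upwards [ae_restrict_mem measurableSet_Ioi] with s hs
    exact hg0 s hs
  have hcake := lintegral_comp_eq_lintegral_meas_lt_mul P
    (show 0 ≤ᵐ[P] f by filter_upwards [hf01] with ω hω using hω.1) hf.aemeasurable
    (fun t _ => hg.intervalIntegrable 0 t) hgae
  have hzero : ∫⁻ s in Set.Ioi (1 : ℝ), P {ω | s < f ω} * ENNReal.ofReal (g s) = 0 := by
    rw [setLIntegral_congr_fun (g := fun _ => 0) measurableSet_Ioi fun s hs => ?_, lintegral_zero]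
    have : P {ω | s < f ω} = 0 := by
      have : ∀ᵐ ω ∂P, ¬ s < f ω := by
        filter_upwards [hf01] with ω hω
        exact not_lt.2 (hω.2.trans (le_of_lt hs))
      simpa [ae_iff] using this
    rw [this, zero_mul]
  rw [← Set.Ioc_union_Ioi_eq_Ioi (zero_le_one' ℝ),
    lintegral_union measurableSet_Ioi (Set.Ioc_disjoint_Ioi le_rfl), hzero, add_zero] at hcake
  rw [intervalIntegral.integral_of_le zero_le_one, integral_eq_lintegral_of_nonneg_ae,
    integral_eq_lintegral_of_nonneg_ae, hcake]
  · congr 1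
    refine setLIntegral_congr_fun measurableSet_Ioc fun s _ => ?_
    rw [ENNReal.ofReal_mul measureReal_nonneg, ofReal_measureReal]
  · filter_upwards [ae_restrict_mem measurableSet_Ioc] with s hs
    exact mul_nonneg measureReal_nonneg (hg0 s hs.1)
  · exact (htail.mul hg.measurable).aestronglyMeasurable
  · filter_upwards [hf01] with ω hω
    refine intervalIntegral.integral_nonneg_of_ae_restrict hω.1 ?_
    rw [← Measure.restrict_congr_set Ioc_ae_eq_Icc]
    filter_upwards [ae_restrict_mem measurableSet_Ioc] with s hs
    exact hg0 s hs.1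
  · exact (hprim.measurable.comp hf).aestronglyMeasurable

lemma integral_one_sub_rpow {γ : ℝ} (hγ : 0 ≤ γ) :
    ∫ s in (0 : ℝ)..1, (1 - s) ^ γ * 1 = 1 / (γ + 1) := by
  simp only [mul_one]
  rw [intervalIntegral.integral_comp_sub_left (fun x : ℝ => x ^ γ) 1, sub_self, sub_zero,
    integral_rpow (Or.inl (by linarith)), Real.one_rpow, Real.zero_rpow (by linarith), sub_zero]

lemma integral_one_sub_rpow_mul {γ : ℝ} (hγ : 0 ≤ γ) :
    ∫ s in (0 : ℝ)..1, (1 - s) ^ γ * (2 * s) = 2 / (γ + 1) - 2 / (γ + 2) := by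
  have h1 := intervalIntegral.integral_comp_sub_left (a := 0) (b := 1)
    (fun x : ℝ => x ^ γ * (2 * (1 - x))) 1
  simp only [sub_sub_cancel, sub_self, sub_zero] at h1
  have h2 : Set.EqOn (fun x : ℝ => x ^ γ * (2 * (1 - x)))
      (fun x => 2 * x ^ γ - 2 * x ^ (γ + 1)) (Set.uIcc 0 1) := fun x hx => by
    rw [Set.uIcc_of_le zero_le_one] at hx
    simp only
    rw [Real.rpow_add_one' hx.1 (by linarith)]
    ring
  have hi : ∀ r : ℝ, 0 ≤ r → IntervalIntegrable (fun x : ℝ => 2 * x ^ r) volume 0 1 := fun r hr =>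
    (intervalIntegral.intervalIntegrable_rpow' (by linarith)).const_mul 2
  rw [h1, intervalIntegral.integral_congr h2,
    intervalIntegral.integral_sub (hi _ hγ) (hi _ (by linarith)),
    intervalIntegral.integral_const_mul, intervalIntegral.integral_const_mul,
    integral_rpow (Or.inl (by linarith)), integral_rpow (Or.inl (by linarith)), Real.one_rpow,
    Real.one_rpow, Real.zero_rpow (by linarith), Real.zero_rpow (by linarith)]
  rw [show γ + 1 + 1 = γ + 2 by ring]
  ring

/-! ### The limiting distribution -/

namespace IsBiddingData

variable {Ω : Type*} [MeasurableSpace Ω] {P : Measure Ω} [IsProbabilityMeasure P] {lam : ℝ}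
  {ν ν₀ : Measure ℝ} [IsProbabilityMeasure ν] {D X : ℕ → Ω → ℝ} {X₀ : Ω → ℝ} {y : ℝ → ℝ} {t : ℝ}

lemma measurable_That (hd : IsBiddingData P lam ν ν₀ D X X₀) (hlam : 0 < lam)
    (hν : Integrable (fun x : ℝ => max x 0) ν) (hν₀ : Integrable (fun x : ℝ => x) ν₀)
    (hμ₀ : 0 ≤ ∫ x, x ∂ν₀) (hy : IsValueCurve ν lam (∫ x, x ∂ν₀) y) (t : ℝ) :
    Measurable (That P D X X₀ t) :=
  (hd.measurable_T hlam hν hν₀ hμ₀ hy t).div_const t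

lemma ae_That_mem_Icc (hd : IsBiddingData P lam ν ν₀ D X X₀) (hlam : 0 < lam)
    (hν : Integrable (fun x : ℝ => max x 0) ν) (hν₀ : Integrable (fun x : ℝ => x) ν₀)
    (hμ₀ : 0 ≤ ∫ x, x ∂ν₀) (hy : IsValueCurve ν lam (∫ x, x ∂ν₀) y) (ht : 0 < t) :
    ∀ᵐ ω ∂P, That P D X X₀ t ω ∈ Set.Icc (0 : ℝ) 1 := by
  filter_upwards [hd.ae_T_mem_Icc hlam hν hν₀ hμ₀ hy ht.le] with ω hω
  exact ⟨div_nonneg hω.1 ht.le, div_le_one_of_le₀ hω.2 ht.le⟩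

lemma measure_lt_That (hd : IsBiddingData P lam ν ν₀ D X X₀) (hlam : 0 < lam)
    (hν : Integrable (fun x : ℝ => max x 0) ν) (hν₀ : Integrable (fun x : ℝ => x) ν₀)
    (hμ₀ : 0 ≤ ∫ x, x ∂ν₀) (hM : ((∫ x, x ∂ν₀ : ℝ) : EReal) < supSupport ν)
    (hy : IsValueCurve ν lam (∫ x, x ∂ν₀) y) (ht : 0 < t) {s : ℝ} (hs : 0 ≤ s) (hs1 : s < 1) :
    P.real {ω | s < That P D X X₀ t ω} = speed ν lam y t / speed ν lam y ((1 - s) * t) := by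
  have h := hd.measure_lt_T hlam hν hν₀ hμ₀ hM hy (t := t) (mul_nonneg hs ht.le)
    (mul_lt_of_lt_one_left ht hs1)
  rw [show (1 - s) * t = t - s * t by ring, ← h]
  simp only [That, lt_div_iff₀ ht]

lemma Hhat_eq (hd : IsBiddingData P lam ν ν₀ D X X₀) (hlam : 0 < lam)
    (hν : Integrable (fun x : ℝ => max x 0) ν) (hν₀ : Integrable (fun x : ℝ => x) ν₀)
    (hμ₀ : 0 ≤ ∫ x, x ∂ν₀) (hM : ((∫ x, x ∂ν₀ : ℝ) : EReal) < supSupport ν)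
    (hy : IsValueCurve ν lam (∫ x, x ∂ν₀) y) (ht : 0 < t) {s : ℝ} (hs : 0 ≤ s) (hs1 : s < 1) :
    Hhat P D X X₀ t s = 1 - speed ν lam y t / speed ν lam y ((1 - s) * t) := by
  rw [← hd.measure_lt_That hlam hν hν₀ hμ₀ hM hy ht hs hs1, ← probReal_compl_eq_one_sub
    (measurableSet_lt measurable_const (hd.measurable_That hlam hν hν₀ hμ₀ hy t)), Hhat]
  congr 1
  ext ω
  simp

lemma Hhat_eq_one (hd : IsBiddingData P lam ν ν₀ D X X₀) (hlam : 0 < lam)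
    (hν : Integrable (fun x : ℝ => max x 0) ν) (hν₀ : Integrable (fun x : ℝ => x) ν₀)
    (hμ₀ : 0 ≤ ∫ x, x ∂ν₀) (hy : IsValueCurve ν lam (∫ x, x ∂ν₀) y) (ht : 0 < t) {s : ℝ}
    (hs : 1 ≤ s) : Hhat P D X X₀ t s = 1 := by
  have h : {ω | That P D X X₀ t ω ≤ s} =ᵐ[P] Set.univ := by
    rw [eventuallyEq_univ]
    filter_upwards [hd.ae_That_mem_Icc hlam hν hν₀ hμ₀ hy ht] with ω hω
    exact hω.2.trans hs
  rw [Hhat, measureReal_congr h, probReal_univ]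

lemma tendsto_Hhat (hd : IsBiddingData P lam ν ν₀ D X X₀) (hlam : 0 < lam)
    (hν : Integrable (fun x : ℝ => max x 0) ν) (hν₀ : Integrable (fun x : ℝ => x) ν₀)
    (hμ₀ : 0 ≤ ∫ x, x ∂ν₀) (hM : ((∫ x, x ∂ν₀ : ℝ) : EReal) < supSupport ν)
    (hy : IsValueCurve ν lam (∫ x, x ∂ν₀) y) {γ : ℝ}
    (hrv : ∀ x, 0 < x →
      Tendsto (fun t => speed ν lam y (x * t) / speed ν lam y t) atTop (𝓝 (x ^ (-γ))))
    {s : ℝ} (hs : 0 ≤ s) :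
    Tendsto (fun t => Hhat P D X X₀ t s) atTop (𝓝 (if s < 1 then 1 - (1 - s) ^ γ else 1)) := by
  split_ifs with hs1
  · have h1 : 0 < 1 - s := by linarith
    refine ((tendsto_div_of_tendsto_ratio h1 (hrv _ h1)).const_sub 1).congr' ?_
    filter_upwards [eventually_gt_atTop 0] with t ht
    exact (hd.Hhat_eq hlam hν hν₀ hμ₀ hM hy ht hs hs1).symm
  · refine tendsto_const_nhds.congr' ?_
    filter_upwards [eventually_gt_atTop 0] with t ht
    exact (hd.Hhat_eq_one hlam hν hν₀ hμ₀ hy ht (not_lt.1 hs1)).symm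

/-- Convergence of the moments, by dominated convergence of the tails. -/
lemma tendsto_integral_That (hd : IsBiddingData P lam ν ν₀ D X X₀) (hlam : 0 < lam)
    (hν : Integrable (fun x : ℝ => max x 0) ν) (hν₀ : Integrable (fun x : ℝ => x) ν₀)
    (hμ₀ : 0 ≤ ∫ x, x ∂ν₀) (hM : ((∫ x, x ∂ν₀ : ℝ) : EReal) < supSupport ν)
    (hy : IsValueCurve ν lam (∫ x, x ∂ν₀) y) {γ : ℝ}
    (hrv : ∀ x, 0 < x →
      Tendsto (fun t => speed ν lam y (x * t) / speed ν lam y t) atTop (𝓝 (x ^ (-γ))))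
    {g : ℝ → ℝ} (hg : Continuous g) (hg0 : ∀ s, 0 < s → 0 ≤ g s) :
    Tendsto (fun t => ∫ ω, (∫ s in 0..That P D X X₀ t ω, g s) ∂P) atTop
      (𝓝 (∫ s in 0..1, (1 - s) ^ γ * g s)) := by
  have htail : ∀ t, Measurable fun s => P.real {ω | s < That P D X X₀ t ω} := fun t =>
    (show Antitone fun s => P.real {ω | s < That P D X X₀ t ω} from fun a b hab =>
      measureReal_mono fun ω hω => hab.trans_lt hω).measurable
  have hlim : Tendsto (fun t => ∫ s in 0..1, P.real {ω | s < That P D X X₀ t ω} * g s) atTop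
      (𝓝 (∫ s in 0..1, (1 - s) ^ γ * g s)) := by
    refine intervalIntegral.tendsto_integral_filter_of_dominated_convergence (fun s => |g s|)
      (Eventually.of_forall fun t => ((htail t).mul hg.measurable).aestronglyMeasurable)
      (Eventually.of_forall fun t => ae_of_all _ fun s _ => ?_)
      (hg.abs.intervalIntegrable 0 1) ?_
    · rw [Real.norm_eq_abs, abs_mul, abs_of_nonneg measureReal_nonneg]
      exact mul_le_of_le_one_left (abs_nonneg _) measureReal_le_one
    · filter_upwards [compl_mem_ae_iff.2 (Real.volume_singleton (a := 1))] with s hs1 hs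
      rw [Set.uIoc_of_le zero_le_one] at hs
      have hs1 : s < 1 := lt_of_le_of_ne hs.2 hs1
      have h1 : 0 < 1 - s := by linarith
      refine Tendsto.mul_const _ ((tendsto_div_of_tendsto_ratio h1 (hrv _ h1)).congr' ?_)
      filter_upwards [eventually_gt_atTop 0] with t ht
      exact (hd.measure_lt_That hlam hν hν₀ hμ₀ hM hy ht hs.1.le hs1).symm
  refine hlim.congr' ?_
  filter_upwards [eventually_gt_atTop 0] with t ht
  exact (integral_intervalIntegral_eq (hd.measurable_That hlam hν hν₀ hμ₀ hy t)
    (hd.ae_That_mem_Icc hlam hν hν₀ hμ₀ hy ht) hg hg0).symm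

lemma tendsto_mean_That (hd : IsBiddingData P lam ν ν₀ D X X₀) (hlam : 0 < lam)
    (hν : Integrable (fun x : ℝ => max x 0) ν) (hν₀ : Integrable (fun x : ℝ => x) ν₀)
    (hμ₀ : 0 ≤ ∫ x, x ∂ν₀) (hM : ((∫ x, x ∂ν₀ : ℝ) : EReal) < supSupport ν)
    (hy : IsValueCurve ν lam (∫ x, x ∂ν₀) y) {γ : ℝ} (hγ : 0 ≤ γ)
    (hrv : ∀ x, 0 < x →
      Tendsto (fun t => speed ν lam y (x * t) / speed ν lam y t) atTop (𝓝 (x ^ (-γ)))) :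
    Tendsto (fun t => ∫ ω, That P D X X₀ t ω ∂P) atTop (𝓝 (1 / (γ + 1))) := by
  have h := hd.tendsto_integral_That hlam hν hν₀ hμ₀ hM hy hrv (g := fun _ => 1)
    continuous_const fun _ _ => zero_le_one
  rw [integral_one_sub_rpow hγ] at h
  simpa using h

lemma tendsto_variance_That (hd : IsBiddingData P lam ν ν₀ D X X₀) (hlam : 0 < lam)
    (hν : Integrable (fun x : ℝ => max x 0) ν) (hν₀ : Integrable (fun x : ℝ => x) ν₀)
    (hμ₀ : 0 ≤ ∫ x, x ∂ν₀) (hM : ((∫ x, x ∂ν₀ : ℝ) : EReal) < supSupport ν)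
    (hy : IsValueCurve ν lam (∫ x, x ∂ν₀) y) {γ : ℝ} (hγ : 0 ≤ γ)
    (hrv : ∀ x, 0 < x →
      Tendsto (fun t => speed ν lam y (x * t) / speed ν lam y t) atTop (𝓝 (x ^ (-γ)))) :
    Tendsto (fun t => variance (That P D X X₀ t) P) atTop
      (𝓝 (γ / ((γ + 1) ^ 2 * (γ + 2)))) := by
  have h2 := hd.tendsto_integral_That hlam hν hν₀ hμ₀ hM hy hrv (g := fun s => 2 * s)
    (by fun_prop) fun s hs => by positivity
  rw [integral_one_sub_rpow_mul hγ] at h2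
  have h1 := hd.tendsto_mean_That hlam hν hν₀ hμ₀ hM hy hγ hrv
  have hval : 2 / (γ + 1) - 2 / (γ + 2) - (1 / (γ + 1)) ^ 2 = γ / ((γ + 1) ^ 2 * (γ + 2)) := by
    have : γ + 1 ≠ 0 := by linarith
    have : γ + 2 ≠ 0 := by linarith
    field_simp
    ring
  rw [← hval]
  refine (h2.sub (h1.pow 2)).congr' ?_
  filter_upwards [eventually_gt_atTop 0] with t ht
  have hmem := hd.ae_That_mem_Icc hlam hν hν₀ hμ₀ hy ht
  have hLp : MemLp (That P D X X₀ t) 2 P :=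
    MemLp.of_bound (hd.measurable_That hlam hν hν₀ hμ₀ hy t).aestronglyMeasurable 1 (by
      filter_upwards [hmem] with ω hω
      rw [Real.norm_of_nonneg hω.1]
      exact hω.2)
  rw [variance_eq_sub hLp]
  congr 2
  ext ω
  rw [intervalIntegral.integral_const_mul, integral_id, Pi.pow_apply]
  ring

lemma hasDerivWithinAt_optimalValue (hd : IsBiddingData P lam ν ν₀ D X X₀) (hlam : 0 < lam)
    (hν : Integrable (fun x : ℝ => max x 0) ν) (hν₀ : Integrable (fun x : ℝ => x) ν₀)
    (hμ₀ : 0 ≤ ∫ x, x ∂ν₀) (hy : IsValueCurve ν lam (∫ x, x ∂ν₀) y) (ht : 0 ≤ t) :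
    HasDerivWithinAt (optimalValue P D X X₀) (speed ν lam y t) (Set.Ici 0) t :=
  (hy.hasDerivAt t ht).hasDerivWithinAt.congr
    (fun _ hr => hd.optimalValue_eq hlam hν hν₀ hμ₀ hy hr)
    (hd.optimalValue_eq hlam hν hν₀ hμ₀ hy ht)

end IsBiddingData

end CayleyMoser

open CayleyMoser in
theorem mainTheorem11 {Ω : Type*} [MeasurableSpace Ω] (P : Measure Ω) [IsProbabilityMeasure P]
    (lam : ℝ) (hlam : 0 < lam)
    (ν ν₀ : Measure ℝ) [IsProbabilityMeasure ν] [IsProbabilityMeasure ν₀]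
    (hν : Integrable (fun x : ℝ => max x 0) ν) (hν₀ : Integrable (fun x : ℝ => x) ν₀)
    (hμ₀ : 0 ≤ ∫ x, x ∂ν₀) (hM : ((∫ x, x ∂ν₀ : ℝ) : EReal) < CayleyMoser.supSupport ν)
    (D X : ℕ → Ω → ℝ) (X₀ : Ω → ℝ)
    (hdata : CayleyMoser.IsBiddingData P lam ν ν₀ D X X₀)
    (μ μ' : ℝ → ℝ) (hμ : μ = CayleyMoser.optimalValue P D X X₀)
    (hμ' : μ' = derivWithin μ (Set.Ici 0)) :
    DifferentiableOn ℝ μ (Set.Ici 0) ∧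
    (CayleyMoser.LimitingDistributionExists P D X X₀ ↔
      ∃ ρ : ℝ, ρ ≤ 0 ∧ CayleyMoser.RegularlyVarying μ' ρ) ∧
    ∀ ρ γ : ℝ, ρ ≤ 0 → γ = -ρ → CayleyMoser.RegularlyVarying μ' ρ →
      (∀ s : ℝ, 0 ≤ s → Tendsto (fun t => CayleyMoser.Hhat P D X X₀ t s) atTop
        (𝓝 (if s < 1 then 1 - (1 - s) ^ γ else 1))) ∧
      Tendsto (fun t => (∫ ω, CayleyMoser.T P D X X₀ t ω ∂P) / t) atTop (𝓝 (1 / (γ + 1))) ∧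
      Tendsto (fun t => ∫ ω, CayleyMoser.That P D X X₀ t ω ∂P) atTop (𝓝 (1 / (γ + 1))) ∧
      Tendsto (fun t => variance (CayleyMoser.T P D X X₀ t) P / t ^ 2) atTop
        (𝓝 (γ / ((γ + 1) ^ 2 * (γ + 2)))) ∧
      Tendsto (fun t => variance (CayleyMoser.That P D X X₀ t) P) atTop
        (𝓝 (γ / ((γ + 1) ^ 2 * (γ + 2)))) := by
  obtain ⟨y, hy⟩ := exists_isValueCurve hν hlam (∫ x, x ∂ν₀)
  subst hμ
  have hderiv : ∀ t, 0 ≤ t → HasDerivWithinAt (optimalValue P D X X₀) (speed ν lam y t)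
      (Set.Ici 0) t := fun t ht => hdata.hasDerivWithinAt_optimalValue hlam hν hν₀ hμ₀ hy ht
  have hμ'eq : ∀ t, 0 ≤ t → μ' t = speed ν lam y t := fun t ht => by
    rw [hμ']
    exact (hderiv t ht).derivWithin (uniqueDiffOn_Ici 0 t ht)
  have hpos : ∀ t, 0 ≤ t → 0 < speed ν lam y t := fun t ht => speed_pos hν hlam hM hy ht
  have hratio : ∀ x : ℝ, 0 < x → (fun t => μ' (x * t) / μ' t) =ᶠ[atTop]
      fun t => speed ν lam y (x * t) / speed ν lam y t := fun x hx => by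
    filter_upwards [eventually_ge_atTop 0] with t ht
    rw [hμ'eq t ht, hμ'eq _ (mul_nonneg hx.le ht)]
  have hrv : ∀ ρ, RegularlyVarying μ' ρ ↔ ∀ x, 0 < x →
      Tendsto (fun t => speed ν lam y (x * t) / speed ν lam y t) atTop (𝓝 (x ^ ρ)) := fun ρ => by
    constructor
    · exact fun h x hx => (h.2.2 x hx).congr' (hratio x hx)
    · refine fun h => ⟨?_, fun t ht => hμ'eq t ht ▸ (hpos t ht).le,
        fun x hx => (h x hx).congr' (hratio x hx).symm⟩
      have : (Set.Ici (0 : ℝ)).domRestrict μ' = fun t : Set.Ici (0 : ℝ) => speed ν lam y t :=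
        funext fun t => hμ'eq t t.2
      rw [this]
      exact (continuous_speed hν hy).measurable.comp measurable_subtype_coe
  have hmain : ∀ ρ, RegularlyVarying μ' ρ → ∀ s : ℝ, 0 ≤ s →
      Tendsto (fun t => Hhat P D X X₀ t s) atTop
        (𝓝 (if s < 1 then 1 - (1 - s) ^ (-ρ) else 1)) := fun ρ hρ s hs =>
    hdata.tendsto_Hhat hlam hν hν₀ hμ₀ hM hy (by simpa using (hrv ρ).1 hρ) hs
  refine ⟨fun t ht => (hderiv t ht).differentiableWithinAt, ⟨?_, ?_⟩, ?_⟩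
  · rintro ⟨κ, hκ, hlim⟩
    obtain ⟨ρ, hρ, h⟩ := exists_rpow_of_tendsto_cdf (κ := κ) (speed_antitone hν hlam hy) hpos
      fun s hs hs1 => (hlim s hs).congr' (by
        filter_upwards [eventually_gt_atTop 0] with t ht
        exact hdata.Hhat_eq hlam hν hν₀ hμ₀ hM hy ht hs hs1)
    exact ⟨ρ, hρ, (hrv ρ).2 h⟩
  · rintro ⟨ρ, hρ, h⟩
    obtain ⟨κ, hκ, hcdf⟩ := exists_cdf_eq_one_sub_rpow (γ := -ρ) (by linarith)
    exact ⟨κ, hκ, fun s hs => hcdf s hs ▸ hmain ρ h s hs⟩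
  · rintro ρ γ hρ rfl h
    have hγ : 0 ≤ -ρ := by linarith
    have hrv' : ∀ x, 0 < x → Tendsto (fun t => speed ν lam y (x * t) / speed ν lam y t) atTop
        (𝓝 (x ^ (- -ρ))) := by simpa using (hrv ρ).1 h
    have hmean := hdata.tendsto_mean_That hlam hν hν₀ hμ₀ hM hy hγ hrv'
    have hvar := hdata.tendsto_variance_That hlam hν hν₀ hμ₀ hM hy hγ hrv'
    refine ⟨hmain ρ h, ?_, hmean, ?_, hvar⟩
    · exact hmean.congr fun t => integral_div t _
    · refine hvar.congr fun t => ?_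
      have : That P D X X₀ t = fun ω => t⁻¹ * T P D X X₀ t ω :=
        funext fun ω => div_eq_inv_mul _ _
      rw [this, variance_const_mul, inv_pow, inv_mul_eq_div]
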